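/- Let $t\in[0,1)$ and $\tau>0$. **Six-vertex model.** Fix $a\in(0,1)$. Consider up-right paths on the half-quadrant $\{(x,y)\in\mathbb Z_{>0}^2: x\le y\}$. A path enters from the left in every row, i.e. through the west edge of $(1,y)$ for every $y\ge 1$. At each vertex $(x,y)$ with $x<y$ the outgoing edges are sampled, independently over vertices, given the incoming ones: if no path or two paths enter, then both outgoing edges are empty, respectively occupied; a single path entering from the west leaves to the east with probability $\frac{1-a^2}{1-ta^2}$ and to the north otherwise; a single path entering from the south leaves to the north with probability $\frac{t(1-a^2)}{1-ta^2}$ and to the east otherwise. At the corner $(x,x)$ a path arriving from the west is absorbed, and if none arrives a new path is created and leaves to the north. For $x\le y$ let $\mathfrak h(x,y)$ be the number of $i\in\{1,\dots,x\}$ such that the north edge of the vertex $(i,y)$ is occupied. **Half-line ASEP.** Let $(\eta(s))_{s\ge0}$ be the half-line ASEP on $\{0,1\}^{\mathbb Z_{>0}}$ started from the empty configuration: a particle jumps from $x$ to $x+1$ at rate $\eta_x(1-\eta_{x+1})$ and from $x+1$ to $x$ at rate $t\,\eta_{x+1}(1-\eta_x)$ ($x\ge1$), and a particle is created at site $1$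 at rate $\frac12(1-\eta_1)$ and annihilated there at rate $\frac t2\eta_1$. (Precisely: $\eta$ is an adapted càdlàg process solving the martingale problem for the corresponding generator on functions of finitely many sites.) Let $N_x(s)=\sum_{i\ge x}\eta_i(s)$ and $N(s)=N_1(s)$. For an integer $k$ let $\lceil k\rceil_2=\min\{i\in2\mathbb Z: i\ge k\}$. **Claim.** Almost surely there are only finitely many particles at time $\tau$. Set $a=1-\frac{(1-t)\varepsilon}{2}$ and $n=\lfloor\tau/\varepsilon\rfloor$. Then for every $x\in\{1,2,\dots\}$, $$n-x-\mathfrak h(n-x,n)\ \Longrightarrow\ N_x(\tau)\qquad\text{as }\varepsilon\to0^+,$$ where $\Rightarrow$ is convergence in distribution. Moreover, as $\varepsilon\to0^+$ along those $\varepsilon$ for which $n$ is even, $$n-\mathfrak h(n,n)\ \Longrightarrow\ \lceil N(\tau)\rceil_2 .$$ -/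

import Mathlib

open MeasureTheory Filter
open scoped Topology NNReal ENNReal

/-! ### The stochastic six-vertex model in the half-quadrant `{(x, y) : 1 ≤ x ≤ y}`

Edge states are Booleans, `true` meaning that the edge is occupied by an up-right path. -/

/-- Boltzmann weight `w_b(i₁, i₂; j₁, j₂)` of a bulk vertex, where `b = a_x a_y`, with incoming
states `i₁` (west) and `i₂` (south) and outgoing states `j₁` (east) and `j₂` (north). -/
noncomputable def bulkWeight (t b : ℝ) : Bool → Bool → Bool → Bool → ℝ
  | false, false, false, false => 1
  | true, true, true, true => 1
  | true, false, true, false => (1 - b) / (1 - t * b)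
  | false, true, false, true => t * (1 - b) / (1 - t * b)
  | true, false, false, true => (1 - t) * b / (1 - t * b)
  | false, true, true, false => (1 - t) / (1 - t * b)
  | _, _, _, _ => 0

open scoped Classical in
/-- Sampling of the outgoing states `(east, north)` of a bulk vertex given its incoming states
`i₁` (west) and `i₂` (south). The number `u` is a sample of a uniform random variable on `[0, 1]`;
when exactly one path enters, it leaves straight with probability `bulkWeight t b i₁ i₂ i₁ i₂`
and turns otherwise. -/
noncomputable def bulkOutput (t b u : ℝ) (i₁ i₂ : Bool) : Bool × Bool :=
  if i₁ = i₂ then (i₁, i₂)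
  else if u ≤ bulkWeight t b i₁ i₂ i₁ i₂ then (i₁, i₂) else (i₂, i₁)

/-- The probability space carrying one independent uniform variable on `[0, 1]` per vertex. -/
abbrev SixVertexSpace : Type := ℕ × ℕ → unitInterval

/-- The law of the independent uniform variables. -/
noncomputable def sixVertexMeasure : Measure SixVertexSpace :=
  Measure.infinitePi fun _ : ℕ × ℕ => (volume : Measure unitInterval)

instance : IsProbabilityMeasure sixVertexMeasure := by
  unfold sixVertexMeasure; infer_instance

/-- State of the east edge of the vertex `(x, y)` (equivalently, the west edge of `(x + 1, y)`) for
a row with south edge states `south`. Column `0` stands for the left boundary, through which a path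
enters in every row. Here `a` is the family of vertex parameters, and `U` is the sample. -/
noncomputable def eastEdge (t : ℝ) (a : ℕ → ℝ) (U : SixVertexSpace) (y : ℕ) (south : ℕ → Bool) :
    ℕ → Bool
  | 0 => true
  | x + 1 =>
      (bulkOutput t (a (x + 1) * a y) (U (x + 1, y)) (eastEdge t a U y south x) (south (x + 1))).1

/-- State of the north edge of the vertex `(x, y)`, as `northEdge t a U y x`. There is a bulk vertex
at `(x, y)` if `1 ≤ x < y` and a corner vertex if `x = y`; the corner vertex has an occupied north
edge exactly when its west edge is empty. Outside of `1 ≤ x ≤ y` there are no edges. -/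
noncomputable def northEdge (t : ℝ) (a : ℕ → ℝ) (U : SixVertexSpace) : ℕ → ℕ → Bool
  | 0, _ => false
  | _ + 1, 0 => false
  | y + 1, x + 1 =>
      if x < y then
        (bulkOutput t (a (x + 1) * a (y + 1)) (U (x + 1, y + 1))
          (eastEdge t a U (y + 1) (northEdge t a U y) x) (northEdge t a U y (x + 1))).2
      else if x = y then !(eastEdge t a U (y + 1) (northEdge t a U y) x)
      else false

/-- The height function `h(x, y)`: the number of paths leaving the `y`-th horizontal line upwards
through one of the vertices `(i, y)`, `1 ≤ i ≤ x`. -/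
noncomputable def sixVertexHeight (t : ℝ) (a : ℕ → ℝ) (x y : ℕ) (U : SixVertexSpace) : ℕ :=
  ((Finset.Icc 1 x).filter fun i => northEdge t a U y i = true).card

/-! ### Half-line ASEP -/

/-- Particle configurations on the sites `1, 2, …`; `true` means occupied. -/
abbrev ASEPConfig : Type := ℕ+ → Bool

/-- The generator of half-line ASEP: jumps `x → x + 1` at rate `p η_x (1 - η_{x+1})`, jumps
`x + 1 → x` at rate `q η_{x+1} (1 - η_x)`, creation at site `1` at rate `α (1 - η_1)` and annihilation
at site `1` at rate `γ η_1`. An allowed jump exchanges the occupation variables of the two sites.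
It is meant for functions of finitely many sites, for which the series has finitely many nonzero
terms. -/
noncomputable def asepGenerator (p q α γ : ℝ) (f : ASEPConfig → ℝ) (η : ASEPConfig) : ℝ :=
  (if η 1 = true then γ else α) * (f (Function.update η 1 (!(η 1))) - f η) +
    ∑' x : ℕ+,
      (if η x = true ∧ η (x + 1) = false then p
        else if η x = false ∧ η (x + 1) = true then q else 0) *
        (f (η ∘ Equiv.swap x (x + 1)) - f η)

/-- `η` is a half-line ASEP with rates `p, q, α, γ` started from the empty configuration, with
respect to the filtration `𝓕`: it is adapted with càdlàg paths (for the product topology on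
configurations), it starts with no particle, and it solves the martingale problem for the generator
on functions depending on finitely many sites. -/
structure IsHalfLineASEP (p q α γ : ℝ) {Ω : Type*} {mΩ : MeasurableSpace Ω} (μ : Measure Ω)
    (𝓕 : Filtration ℝ≥0 mΩ) (η : ℝ≥0 → Ω → ASEPConfig) : Prop where
  measurable : ∀ s, Measurable[𝓕 s] (η s)
  right_continuous : ∀ ω s, ContinuousWithinAt (fun r => η r ω) (Set.Ici s) s
  left_limits : ∀ ω s, ∃ l, Tendsto (fun r => η r ω) (𝓝[<] s) (𝓝 l)
  initial : ∀ᵐ ω ∂μ, η 0 ω = fun _ => false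
  martingale : ∀ (f : ASEPConfig → ℝ) (S : Finset ℕ+), DependsOn f (S : Set ℕ+) →
    Martingale (fun s ω => f (η s ω) - f (η 0 ω) -
      ∫ r in (0 : ℝ)..s, asepGenerator p q α γ f (η r.toNNReal ω)) 𝓕 μ

/-- The current `N_x = ∑_{i ≥ x} η_i`, i.e. the number of particles at sites `i ≥ x`
(with value `0` if there are infinitely many). -/
noncomputable def asepCurrent (x : ℕ+) (η : ASEPConfig) : ℕ :=
  Set.ncard {i : ℕ+ | x ≤ i ∧ η i = true}

/-- The smallest even integer `i ≥ k`. -/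
noncomputable def ceilTwo (k : ℤ) : ℤ := sInf {i : ℤ | Even i ∧ k ≤ i}

theorem isLeast_ceilTwo (k : ℤ) : IsLeast {i : ℤ | Even i ∧ k ≤ i} (ceilTwo k) := by
  have hb : BddBelow {i : ℤ | Even i ∧ k ≤ i} := ⟨k, fun i hi => hi.2⟩
  have hn : {i : ℤ | Even i ∧ k ≤ i}.Nonempty := by
    rcases Int.even_or_odd k with h | h
    · exact ⟨k, h, le_rfl⟩
    · exact ⟨k + 1, h.add_one, by omega⟩
  exact ⟨Int.csInf_mem hn hb, fun i hi => csInf_le hb hi⟩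

/-!
Half-line ASEP is the scaling limit of the holes of the six-vertex model, seen from the diagonal.

Let a *hole* at site `i` in row `n` be the absence of a path on the north edge of the vertex
`(n - i, n)`. When a path enters a bulk vertex alone it typically turns, so that typically the holes
at the sites `i ≥ 1` do not move from one row to the next, while the corner site `0` is emptied if it
was occupied and filled if it was empty. An exceptional vertex exchanges the contents of two adjacent
sites: a hole moves away from the diagonal with probability `p` and towards it with probability
`t p`, where `p` is of order `ε` (`jumpProb_scaledParam`). This update is exact as long as at most one
vertex in a window is exceptional (`eq_add_sum_exchange`), and two exceptions cost `O(p ^ 2)`. Site `0`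
alternates between the two states, so over two rows an exchange between the sites `0` and `1` is a
creation with probability `p` and an annihilation with probability `t p`: per row these are the boundary
rates `1 / 2` and `t / 2`. Hence the expectations of local functions of the holes satisfy the
Kolmogorov equation of half-line ASEP up to `O(ε)` (`abs_holesMean_sub_sum_le`). The martingale
problem and Fubini give the equation itself for the ASEP (`IsHalfLineASEP.abs_asepMean_sub_sum_le`).

The equations do not close, because the generator maps functions of `L` sites to functions of `L + 1`
sites, with norm at most `2 (L + 1)`. Iterating `k` times over a time interval of length `s` bounds the
difference of the two expectations by `2 (2 s) ^ k (L + k).choose k`, up to terms that vanish with `ε`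
(`CloseUpTo.iterate`). For `s ≤ 1 / 8` this tends to `0` with `k`, whatever `L` is, so closeness
propagates in time steps of fixed length (`CloseUpTo.add`). Neither a semigroup nor a uniqueness theorem
for the martingale problem is needed.

To pass from local functions to particle numbers one needs tightness. The front of the holes advances by
at most one site per row, and only at an exceptional vertex, so there is a hole at some site `i ≥ K` in
row `n` with probability at most `n.choose K * p ^ K`, which is at most `τ ^ K / K!` in the scaling
limit (`integral_farIndicator_scaled_le`). Local functions carry this bound over to the ASEP
(`measureReal_exists_ge_le`), which gives the almost sure finiteness and the convergence of the
expectations of all bounded functions (`tendsto_integral_comp_holes`).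

The number of holes at the sites `i ≥ x` is `n - x - h(n - x, n)`. The corner either absorbs one path or
creates a second one, so `h(n, n)` is even; for even `n` the quantity `n - h(n, n)` is the even one of
`k` and `k + 1`, where `k` is the number of holes at the sites `i ≥ 1`.
-/

/-! ### The holes of the six-vertex model and their update rule -/

section HoleProcess

variable (t a : ℝ) (U : SixVertexSpace)

/-- The holes of row `n` of the six-vertex model, seen from the diagonal: `holes t a U n i` says that
the north edge of the vertex `(n - i, n)` exists and is empty. Site `0` is the corner vertex. -/
noncomputable def holes (n i : ℕ) : Bool :=
  decide (i < n) && !northEdge t (fun _ => a) U n (n - i)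

/-- The holes on the horizontal edges between row `n` and row `n + 1`: `holeCarry t a U n i` says
that the east edge of the vertex `(n - i, n + 1)` exists and is empty. -/
noncomputable def holeCarry (n i : ℕ) : Bool :=
  decide (i ≤ n) && !eastEdge t (fun _ => a) U (n + 1) (northEdge t (fun _ => a) U n) (n - i)

/-- The vertex of row `n + 1` that acts on the sites `i` and `i + 1`. For `i < n` it is the bulk
vertex `(n - i, n + 1)`; for `i ≥ n`, where both sites are empty, it is a vertex outside of the
half-quadrant, chosen so that different bonds have different vertices. -/
def bondVertex (n i : ℕ) : ℕ × ℕ := (if i < n then n - i else i + 1, n + 1)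

lemma bondVertex_injective (n : ℕ) : Function.Injective (bondVertex n) := by
  intro i j h
  simp only [bondVertex, Prod.mk.injEq, and_true] at h
  split_ifs at h <;> omega

/-- The rate at which the sites of a bond exchange their occupation variables, where `w` is the state
of the outer site and `s` that of the inner one. -/
noncomputable def bondRate (w s : Bool) : ℝ :=
  if s = true ∧ w = false then 1 else if s = false ∧ w = true then t else 0

/-- The probability that a path entering a bulk vertex from the west goes straight. -/
noncomputable def jumpProb : ℝ := (1 - a * a) / (1 - t * (a * a))

lemma holes_zero : holes t a U 0 = fun _ => false := by
  ext i; simp [holes]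

lemma holes_of_le {n i : ℕ} (h : n ≤ i) : holes t a U n i = false := by
  simp [holes, Nat.not_lt.2 h]

lemma holes_succ_zero (n : ℕ) : holes t a U (n + 1) 0 = !holeCarry t a U n 0 := by
  simp [holes, holeCarry, northEdge]

/-- The update rule of the holes in one row, from the far sites towards the diagonal. -/
lemma holes_update (n i : ℕ) :
    if (U (bondVertex n i) : ℝ) ≤ jumpProb t a * bondRate t (holeCarry t a U n (i + 1)) (holes t a U n i)
    then holeCarry t a U n i = holeCarry t a U n (i + 1) ∧
      holes t a U (n + 1) (i + 1) = holes t a U n i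
    else holeCarry t a U n i = holes t a U n i ∧
      holes t a U (n + 1) (i + 1) = holeCarry t a U n (i + 1) := by
  rcases lt_or_ge i n with h | h
  · obtain ⟨x, rfl⟩ : ∃ x, n = x + i + 1 := ⟨n - i - 1, by omega⟩
    have e1 : x + i + 1 - i = x + 1 := by omega
    have e2 : x + i + 1 - (i + 1) = x := by omega
    have e3 : x + i + 1 + 1 - (i + 1) = x + 1 := by omega
    simp only [holes, holeCarry, bondVertex, e1, e2, e3, h, if_true, decide_true, Bool.true_and]
    have h1 : i ≤ x + i + 1 := by omega
    have h2 : i + 1 ≤ x + i + 1 := by omega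
    have h3 : i + 1 < x + i + 1 + 1 := by omega
    have h4 : x < x + i + 1 := by omega
    have hN : northEdge t (fun _ => a) U (x + i + 1 + 1) (x + 1) =
      (bulkOutput t (a * a) (U (x + 1, x + i + 1 + 1))
        (eastEdge t (fun _ => a) U (x + i + 1 + 1) (northEdge t (fun _ => a) U (x + i + 1)) x)
        (northEdge t (fun _ => a) U (x + i + 1) (x + 1))).2 := by
      rw [northEdge, if_pos h4]
    have hE : eastEdge t (fun _ => a) U (x + i + 1 + 1) (northEdge t (fun _ => a) U (x + i + 1))
        (x + 1) = (bulkOutput t (a * a) (U (x + 1, x + i + 1 + 1))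
        (eastEdge t (fun _ => a) U (x + i + 1 + 1) (northEdge t (fun _ => a) U (x + i + 1)) x)
        (northEdge t (fun _ => a) U (x + i + 1) (x + 1))).1 := by
      rw [eastEdge]
    rw [hN, hE]
    simp only [h1, h2, h3, decide_true, Bool.true_and]
    generalize eastEdge t (fun _ => a) U (x + i + 1 + 1) (northEdge t (fun _ => a) U (x + i + 1)) x = w
    generalize northEdge t (fun _ => a) U (x + i + 1) (x + 1) = s
    have h5 : t * (1 - a * a) / (1 - t * (a * a)) = jumpProb t a * t := by
      rw [jumpProb]; ring
    have h6 : (1 - a * a) / (1 - t * (a * a)) = jumpProb t a := rfl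
    cases w <;> cases s <;> simp [bulkOutput, bondRate, bulkWeight, h5, h6] <;> split_ifs <;> simp
  · have h1 : holeCarry t a U n (i + 1) = false := by simp [holeCarry, Nat.not_le.2 (by omega : n < i + 1)]
    have h2 : holeCarry t a U n i = false := by
      rcases h.eq_or_lt with rfl | h
      · simp [holeCarry, eastEdge]
      · simp [holeCarry, Nat.not_le.2 h]
    rw [h1, h2, holes_of_le t a U h, holes_of_le t a U (by omega : n + 1 ≤ i + 1)]
    simp

end HoleProcess

/-- The alternation of site `0` that takes place in every row. -/
def flipZero (ξ : ℕ → Bool) : ℕ → Bool := Function.update ξ 0 (!ξ 0)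

/-- If at most one of the vertices near the diagonal lies below the level `p`, one row update flips
site `0` after at most one exchange of adjacent sites. -/
lemma eq_add_sum_exchange {t p : ℝ} (ht1 : t < 1) (hp : 0 ≤ p) {L : ℕ} {V : ℕ → ℝ}
    {ξ ξ' W : ℕ → Bool} (h0 : ξ' 0 = !W 0)
    (h : ∀ i, if V i ≤ p * bondRate t (W (i + 1)) (ξ i) then W i = W (i + 1) ∧ ξ' (i + 1) = ξ i
      else W i = ξ i ∧ ξ' (i + 1) = W (i + 1))
    (hV : ∀ i ≤ L + 1, ∀ j ≤ L + 1, V i ≤ p → V j ≤ p → i = j)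
    {g : (ℕ → Bool) → ℝ} (hg : DependsOn g (Set.Iic L)) :
    g ξ' = g (flipZero ξ) + ∑ i ∈ Finset.range (L + 1),
      if V i ≤ p * bondRate t (ξ (i + 1)) (ξ i)
        then g (flipZero (ξ ∘ Equiv.swap i (i + 1))) - g (flipZero ξ) else 0 := by
  have hr : ∀ w s, p * bondRate t w s ≤ p := by
    intro w s
    have : bondRate t w s ≤ 1 := by unfold bondRate; split_ifs <;> linarith
    nlinarith
  have hn : ∀ i, p < V i → W i = ξ i ∧ ξ' (i + 1) = W (i + 1) := by
    intro i hi
    have := h i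
    rwa [if_neg (not_le.2 ((hr _ _).trans_lt hi))] at this
  by_cases hex : ∃ i ≤ L, V i ≤ p
  · obtain ⟨i, hiL, hi⟩ := hex
    have hne : ∀ j ≤ L + 1, j ≠ i → p < V j := fun j hj hji =>
      not_le.1 fun hVj => hji (hV j hj i (by omega) hVj hi)
    have hW : W (i + 1) = ξ (i + 1) := (hn _ (hne (i + 1) (by omega) (by omega))).1
    rw [Finset.sum_eq_single_of_mem i (Finset.mem_range.2 (by omega))]
    · have hi' := h i
      rw [hW] at hi'
      split_ifs at hi' ⊢ with hc
      · rw [add_sub_cancel]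
        refine hg fun k hk => ?_
        simp only [Set.mem_Iic] at hk
        rcases k with _ | k
        · rw [h0]
          rcases Nat.eq_zero_or_pos i with rfl | hpos
          · simp [flipZero, hi'.1]
          · have := (hn 0 (hne 0 (by omega) (by omega))).1
            simp [flipZero, this, Equiv.swap_apply_of_ne_of_ne hpos.ne]
        · rcases eq_or_ne k i with rfl | hki
          · simp [flipZero, hi'.2]
          · rw [(hn k (hne k (by omega) hki)).2]
            rcases eq_or_ne (k + 1) i with rfl | hki'
            · simp [flipZero, hi'.1]
            · rw [(hn (k + 1) (hne _ (by omega) hki')).1]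
              simp [flipZero, Equiv.swap_apply_of_ne_of_ne hki' (by omega : k + 1 ≠ i + 1)]
      · rw [add_zero]
        refine hg fun k hk => ?_
        simp only [Set.mem_Iic] at hk
        have hWk : ∀ k ≤ L, W k = ξ k := by
          intro k hk
          rcases eq_or_ne k i with rfl | hki
          · exact hi'.1
          · exact (hn k (hne _ (by omega) hki)).1
        rcases k with _ | k
        · rw [h0, hWk 0 (by omega)]; simp [flipZero]
        · have : ξ' (k + 1) = W (k + 1) := by
            rcases eq_or_ne k i with rfl | hki
            · rw [hi'.2, hW]
            · exact (hn k (hne k (by omega) hki)).2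
          rw [this, hWk _ hk]; simp [flipZero]
    · intro j hj hji
      rw [if_neg]
      exact not_le.2 ((hr _ _).trans_lt (hne j (by have := Finset.mem_range.1 hj; omega) hji))
  · push Not at hex
    rw [Finset.sum_eq_zero, add_zero]
    · refine hg fun k hk => ?_
      simp only [Set.mem_Iic] at hk
      rcases k with _ | k
      · rw [h0, (hn 0 (hex 0 (by omega))).1]; simp [flipZero]
      · rw [(hn k (hex k (by omega))).2, (hn (k + 1) (hex _ hk)).1]; simp [flipZero]
    · intro j hj
      rw [if_neg]
      exact not_le.2 ((hr _ _).trans_lt (hex j (by have := Finset.mem_range.1 hj; omega)))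

/-! ### Local functions, measurability and independence -/

section LocalFunctions

variable {ι β : Type*} {f : (ι → Bool) → β} {S : Set ι}

lemma DependsOn.continuous_bool [Nonempty β] [TopologicalSpace β] (hf : DependsOn f S)
    (hS : S.Finite) : Continuous f := by
  obtain ⟨g, rfl⟩ := dependsOn_iff_exists_comp.1 hf
  have := hS.to_subtype
  exact (continuous_of_discreteTopology (f := g)).comp (by fun_prop)

lemma DependsOn.measurable_bool [Nonempty β] [MeasurableSpace β] (hf : DependsOn f S)
    (hS : S.Finite) : Measurable f := by
  obtain ⟨g, rfl⟩ := dependsOn_iff_exists_comp.1 hf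
  have := hS.to_subtype
  exact (measurable_of_finite g).comp (by fun_prop)

end LocalFunctions

section Measurability

variable {t : ℝ} {a : ℕ → ℝ}

lemma eastEdge_congr {U U' : SixVertexSpace} {y : ℕ} {s : ℕ → Bool} {m : ℕ}
    (h : ∀ x ≤ m, U (x, y) = U' (x, y)) : eastEdge t a U y s m = eastEdge t a U' y s m := by
  induction m with
  | zero => rfl
  | succ m ih => rw [eastEdge, eastEdge, ih fun x hx => h x (by omega), h (m + 1) le_rfl]

/-- The states in row `n` are functions of the samples at the vertices `(x, y)` with
`x ≤ n` and `y ≤ n`. -/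
lemma northEdge_congr {U U' : SixVertexSpace} {n : ℕ}
    (h : ∀ x ≤ n, ∀ y ≤ n, U (x, y) = U' (x, y)) : northEdge t a U n = northEdge t a U' n := by
  induction n with
  | zero => ext x; cases x <;> rfl
  | succ n ih =>
    ext x
    rcases x with _ | x
    · rfl
    · rw [northEdge, northEdge, ih fun x hx y hy => h x (by omega) y (by omega)]
      split_ifs with h1 h2
      · rw [h (x + 1) (by omega) (n + 1) le_rfl,
          eastEdge_congr fun x' hx' => h x' (by omega) (n + 1) le_rfl]
      · rw [eastEdge_congr fun x' hx' => h x' (by omega) (n + 1) le_rfl]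
      · rfl

lemma measurable_bulkOutput {Ω : Type*} [MeasurableSpace Ω] (t b : ℝ) {u : Ω → unitInterval}
    {i j : Ω → Bool} (hu : Measurable u) (hi : Measurable i) (hj : Measurable j) :
    Measurable fun ω => bulkOutput t b (u ω) (i ω) (j ω) := by
  have h : Measurable fun q : unitInterval × (Bool × Bool) => bulkOutput t b q.1 q.2.1 q.2.2 := by
    refine measurable_from_prod_countable_left fun q => ?_
    simp only [bulkOutput]
    refine Measurable.ite (MeasurableSet.const _) measurable_const
      (Measurable.ite ?_ measurable_const measurable_const)
    exact measurableSet_le measurable_subtype_coe measurable_const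
  exact h.comp (hu.prodMk (hi.prodMk hj))

lemma measurable_eastEdge (y : ℕ) {s : SixVertexSpace → ℕ → Bool}
    (hs : ∀ x, Measurable fun U => s U x) (m : ℕ) :
    Measurable fun U => eastEdge t a U y (s U) m := by
  induction m with
  | zero => exact measurable_const
  | succ m ih => exact (measurable_bulkOutput _ _ (measurable_pi_apply (_ : ℕ × ℕ)) ih (hs _)).fst

lemma measurable_northEdge (n x : ℕ) : Measurable fun U => northEdge t a U n x := by
  induction n generalizing x with
  | zero => cases x <;> exact measurable_const
  | succ n ih =>
    rcases x with _ | x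
    · exact measurable_const
    · simp only [northEdge]
      split_ifs
      · exact (measurable_bulkOutput _ _ (measurable_pi_apply (_ : ℕ × ℕ)) (measurable_eastEdge _ ih _)
          (ih _)).snd
      · exact (Measurable.of_discrete (f := not)).comp (measurable_eastEdge _ ih _)
      · exact measurable_const

lemma measurable_holes (t a : ℝ) (n : ℕ) : Measurable fun U => holes t a U n := by
  refine measurable_pi_lambda _ fun i => ?_
  exact (Measurable.of_discrete (f := fun b => decide (i < n) && !b)).comp (measurable_northEdge _ _)

lemma holes_congr {t a : ℝ} {U U' : SixVertexSpace} {n : ℕ}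
    (h : ∀ x ≤ n, ∀ y ≤ n, U (x, y) = U' (x, y)) : holes t a U n = holes t a U' n := by
  ext i
  rw [holes, holes, northEdge_congr h]

end Measurability

section Independence

/-- A sample is independent of every function of finitely many other samples. -/
lemma integral_indicator_le_mul (c : ℕ × ℕ) {r : ℝ} (hr0 : 0 ≤ r) (hr1 : r ≤ 1)
    {k : SixVertexSpace → ℝ} (hk : Measurable k) {S : Finset (ℕ × ℕ)} (hcS : c ∉ S)
    (hkS : DependsOn k (S : Set (ℕ × ℕ))) :
    ∫ U, (if (U c : ℝ) ≤ r then 1 else 0) * k U ∂sixVertexMeasure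
      = r * ∫ U, k U ∂sixVertexMeasure := by
  classical
  have hind : ProbabilityTheory.iIndepFun (fun (i : ℕ × ℕ) (U : SixVertexSpace) => U i)
      sixVertexMeasure :=
    ProbabilityTheory.iIndepFun_infinitePi (X := fun _ u => u) (fun _ => measurable_id)
  have h1 := hind.indepFun_finset {c} S (by simpa using hcS) (fun i => measurable_pi_apply i)
  let ext : ((i : S) → unitInterval) → SixVertexSpace := fun v i => if h : i ∈ S then v ⟨i, h⟩ else 0
  have hext : Measurable ext := by
    refine measurable_pi_lambda _ fun i => ?_
    by_cases h : i ∈ S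
    · simp only [ext, h, dif_pos]; exact measurable_pi_apply _
    · simp only [ext, h, dif_neg, not_false_eq_true]; exact measurable_const
  have hφ : Measurable fun v : ((i : ({c} : Finset (ℕ × ℕ))) → unitInterval) =>
      if (v ⟨c, Finset.mem_singleton_self c⟩ : ℝ) ≤ r then (1 : ℝ) else 0 :=
    Measurable.ite (measurableSet_le (measurable_subtype_coe.comp (measurable_pi_apply _))
      measurable_const) measurable_const measurable_const
  have h2 := h1.comp hφ (hk.comp hext)
  have e2 : ((k ∘ ext) ∘ fun (U : SixVertexSpace) (i : S) => U i) = k := by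
    ext U
    refine hkS fun i hi => ?_
    have hi' : i ∈ S := hi
    simp [ext, hi']
  rw [e2] at h2
  have h3 := h2.integral_fun_mul_eq_mul_integral
    ((hφ.comp (by fun_prop)).aestronglyMeasurable) hk.aestronglyMeasurable
  simp only [Function.comp_apply] at h3
  rw [h3]
  congr 1
  have h4 : (fun U : SixVertexSpace => if (U c : ℝ) ≤ r then (1 : ℝ) else 0)
      = ((fun U : SixVertexSpace => U c) ⁻¹' {u : unitInterval | (u : ℝ) ≤ r}).indicator 1 := by
    ext U; simp [Set.indicator_apply]
  have hm : MeasurableSet {u : unitInterval | (u : ℝ) ≤ r} :=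
    measurableSet_le measurable_subtype_coe measurable_const
  rw [h4, integral_indicator_one (measurable_pi_apply c hm),
    measureReal_def, sixVertexMeasure,
    (measurePreserving_eval_infinitePi (fun _ : ℕ × ℕ => (volume : Measure unitInterval)) c
      ).measure_preimage hm.nullMeasurableSet]
  have h5 : {u : unitInterval | (u : ℝ) ≤ r} = Set.Iic ⟨r, hr0, hr1⟩ := rfl
  rw [h5, unitInterval.volume_Iic, ENNReal.toReal_ofReal hr0]

lemma integral_indicator_le_mul_holes {t a : ℝ} (n i : ℕ) {r : ℝ} (hr0 : 0 ≤ r) (hr1 : r ≤ 1)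
    {k : (ℕ → Bool) → ℝ} (hk : Measurable k) :
    ∫ U, (if (U (bondVertex n i) : ℝ) ≤ r then 1 else 0) * k (holes t a U n) ∂sixVertexMeasure
      = r * ∫ U, k (holes t a U n) ∂sixVertexMeasure := by
  refine integral_indicator_le_mul _ hr0 hr1 (hk.comp (measurable_holes t a n))
    (S := Finset.range (n + 1) ×ˢ Finset.range (n + 1)) (by simp [bondVertex]) ?_
  intro U U' h
  simp only
  rw [holes_congr fun x hx y hy => h (x, y) (by simp; omega)]

end Independence

lemma measurable_flipZero : Measurable flipZero := by
  refine measurable_pi_lambda _ fun i => ?_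
  rcases Nat.eq_zero_or_pos i with rfl | h
  · simp only [flipZero, Function.update_self]
    exact (Measurable.of_discrete (f := not)).comp (measurable_pi_apply 0)
  · simp only [flipZero, Function.update_of_ne h.ne']
    exact measurable_pi_apply i

lemma DependsOn.comp_flipZero {g : (ℕ → Bool) → ℝ} {S : Set ℕ} (hg : DependsOn g S) :
    DependsOn (fun ξ => g (flipZero ξ)) S := by
  intro ξ ξ' h
  refine hg fun i hi => ?_
  rcases Nat.eq_zero_or_pos i with rfl | h'
  · simp [flipZero, h 0 hi]
  · rw [flipZero, flipZero, Function.update_of_ne h'.ne', Function.update_of_ne h'.ne', h i hi]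

lemma DependsOn.comp_swap {ι β : Type*} [DecidableEq ι] {g : (ι → Bool) → β} {S T : Set ι}
    (hg : DependsOn g S) {i j : ι} (hST : S ⊆ T) (hi : i ∈ T) (hj : j ∈ T) :
    DependsOn (fun ξ => g (ξ ∘ Equiv.swap i j)) T := by
  intro ξ ξ' h
  refine hg fun k hk => ?_
  simp only [Function.comp_apply]
  apply h
  rcases eq_or_ne k i with rfl | h1
  · simpa using hj
  rcases eq_or_ne k j with rfl | h2
  · simpa using hi
  rw [Equiv.swap_apply_of_ne_of_ne h1 h2]; exact hST hk

/-- The first-order term of the row update on functions of the sites `0, …, L`. -/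
noncomputable def exchangeGenerator (t : ℝ) (L : ℕ) (g : (ℕ → Bool) → ℝ) (ξ : ℕ → Bool) : ℝ :=
  ∑ i ∈ Finset.range (L + 1), bondRate t (ξ (i + 1)) (ξ i) *
    (g (flipZero (ξ ∘ Equiv.swap i (i + 1))) - g (flipZero ξ))

lemma bondRate_nonneg {t : ℝ} (ht0 : 0 ≤ t) (w s : Bool) : 0 ≤ bondRate t w s := by
  unfold bondRate; split_ifs <;> linarith

lemma bondRate_le_one {t : ℝ} (ht1 : t < 1) (w s : Bool) : bondRate t w s ≤ 1 := by
  unfold bondRate; split_ifs <;> linarith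

lemma comp_swap_eq_self {ι β : Type*} [DecidableEq ι] {ξ : ι → β} {i j : ι} (h : ξ i = ξ j) :
    ξ ∘ Equiv.swap i j = ξ := by
  ext k
  simp only [Function.comp_apply, Equiv.swap_apply_def]
  split_ifs with h1 h2
  · rw [h1, h]
  · rw [h2, h]
  · rfl

lemma exchangeGenerator_dependsOn (t : ℝ) {L : ℕ} {g : (ℕ → Bool) → ℝ}
    (hg : DependsOn g (Set.Iic L)) : DependsOn (exchangeGenerator t L g) (Set.Iic (L + 1)) := by
  intro ξ ξ' h
  refine Finset.sum_congr rfl fun i hi => ?_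
  have hi' : i ≤ L := by have := Finset.mem_range.1 hi; omega
  have h1 : g (flipZero ξ) = g (flipZero ξ') :=
    hg.comp_flipZero fun k hk => h k (Set.Iic_subset_Iic.2 (Nat.le_succ L) hk)
  have h2 : g (flipZero (ξ ∘ Equiv.swap i (i + 1))) = g (flipZero (ξ' ∘ Equiv.swap i (i + 1))) :=
    hg.comp_flipZero.comp_swap (T := Set.Iic (L + 1)) (Set.Iic_subset_Iic.2 (Nat.le_succ L))
      (i := i) (j := i + 1) (by simp; omega) (by simp; omega) h
  rw [h i (by simp; omega), h (i + 1) (by simp; omega), h1, h2]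

lemma abs_exchangeGenerator_le {t : ℝ} (ht0 : 0 ≤ t) (ht1 : t < 1) {L : ℕ} {g : (ℕ → Bool) → ℝ}
    {M : ℝ} (hM : ∀ ξ, |g ξ| ≤ M) (ξ : ℕ → Bool) :
    |exchangeGenerator t L g ξ| ≤ (L + 1) * (2 * M) := by
  refine (Finset.abs_sum_le_sum_abs _ _).trans ?_
  calc _ ≤ ∑ _i ∈ Finset.range (L + 1), 2 * M := Finset.sum_le_sum fun i _ => by
        rw [abs_mul, abs_of_nonneg (bondRate_nonneg ht0 _ _)]
        have h1 := abs_sub (g (flipZero (ξ ∘ Equiv.swap i (i + 1)))) (g (flipZero ξ))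
        have h2 := hM (flipZero (ξ ∘ Equiv.swap i (i + 1)))
        have h3 := hM (flipZero ξ)
        have h4 := bondRate_le_one ht1 (ξ (i + 1)) (ξ i)
        calc _ ≤ 1 * (2 * M) := mul_le_mul h4 (by linarith) (abs_nonneg _) zero_le_one
          _ = _ := one_mul _
    _ = _ := by simp

lemma integrable_of_bounded_holes {t a : ℝ} {n : ℕ} {k : (ℕ → Bool) → ℝ} (hk : Measurable k) {M : ℝ}
    (hM : ∀ ξ, |k ξ| ≤ M) : Integrable (fun U => k (holes t a U n)) sixVertexMeasure :=
  Integrable.of_bound (hk.comp (measurable_holes t a n)).aestronglyMeasurable M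
    (ae_of_all _ fun _ => hM _)

/-! ### Expansion of the evolution over one row -/

section OneStep

variable {t a : ℝ}

/-- The expected number of ordered pairs of vertices near the diagonal in one row whose samples both
lie below the level `p` is of order `p ^ 2`. -/
lemma integral_sum_offDiag_le (n L : ℕ) {p : ℝ} (hp0 : 0 ≤ p) (hp1 : p ≤ 1) :
    Integrable (fun U : SixVertexSpace => ∑ q ∈ (Finset.range L).offDiag,
        (if (U (bondVertex n q.1) : ℝ) ≤ p then (1 : ℝ) else 0) *
          (if (U (bondVertex n q.2) : ℝ) ≤ p then 1 else 0)) sixVertexMeasure ∧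
      ∫ U : SixVertexSpace, ∑ q ∈ (Finset.range L).offDiag,
        (if (U (bondVertex n q.1) : ℝ) ≤ p then (1 : ℝ) else 0) *
          (if (U (bondVertex n q.2) : ℝ) ≤ p then 1 else 0) ∂sixVertexMeasure ≤ L ^ 2 * p ^ 2 := by
  have hm : ∀ c : ℕ × ℕ, Measurable fun U : SixVertexSpace =>
      if (U c : ℝ) ≤ p then (1 : ℝ) else 0 := fun c =>
    Measurable.ite (measurableSet_le (measurable_subtype_coe.comp (measurable_pi_apply _))
      measurable_const) measurable_const measurable_const
  have hi : ∀ q ∈ (Finset.range L).offDiag, Integrable (fun U : SixVertexSpace =>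
      (if (U (bondVertex n q.1) : ℝ) ≤ p then (1 : ℝ) else 0) *
          (if (U (bondVertex n q.2) : ℝ) ≤ p then 1 else 0)) sixVertexMeasure := fun q _ =>
    Integrable.of_bound ((hm _).mul (hm _)).aestronglyMeasurable 1
      (ae_of_all _ fun U => by split_ifs <;> simp)
  refine ⟨integrable_finsetSum _ hi, ?_⟩
  rw [integral_finsetSum _ hi]
  have hq : ∀ q ∈ (Finset.range L).offDiag, ∫ U : SixVertexSpace,
      (if (U (bondVertex n q.1) : ℝ) ≤ p then (1 : ℝ) else 0) *
          (if (U (bondVertex n q.2) : ℝ) ≤ p then 1 else 0) ∂sixVertexMeasure = p ^ 2 := by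
    intro q hq
    have hne : bondVertex n q.1 ≠ bondVertex n q.2 :=
      fun h => (Finset.mem_offDiag.1 hq).2.2 (bondVertex_injective n h)
    rw [integral_indicator_le_mul _ hp0 hp1 (hm _) (S := {bondVertex n q.2}) (by simpa using hne)
      (fun U U' h => by rw [h _ (by simp)])]
    have := integral_indicator_le_mul (bondVertex n q.2) hp0 hp1 (k := fun _ => 1) measurable_const
      (S := ∅) (by simp) (fun U U' h => rfl)
    simp only [mul_one, integral_const, probReal_univ, smul_eq_mul] at this
    rw [this]; ring
  rw [Finset.sum_congr rfl hq, Finset.sum_const, nsmul_eq_mul, Finset.offDiag_card,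
    Finset.card_range]
  refine mul_le_mul_of_nonneg_right ?_ (by positivity)
  have : ((L * L - L : ℕ) : ℝ) ≤ ((L * L : ℕ) : ℝ) := Nat.cast_le.2 (Nat.sub_le _ _)
  refine this.trans (by push_cast; nlinarith)

/-- Expected contribution of the exchange at one bond. -/
lemma integral_exchange (ht0 : 0 ≤ t) (ht1 : t < 1) (hp0 : 0 ≤ jumpProb t a)
    (hp1 : jumpProb t a ≤ 1) {n i : ℕ} {d : (ℕ → Bool) → ℝ} (hd : Measurable d) {M : ℝ}
    (hM : ∀ ξ, |d ξ| ≤ M) (h0 : ∀ ξ, ξ i = ξ (i + 1) → d ξ = 0) :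
    Integrable (fun U => if (U (bondVertex n i) : ℝ) ≤
        jumpProb t a * bondRate t (holes t a U n (i + 1)) (holes t a U n i)
        then d (holes t a U n) else 0) sixVertexMeasure ∧
    ∫ U, (if (U (bondVertex n i) : ℝ) ≤
        jumpProb t a * bondRate t (holes t a U n (i + 1)) (holes t a U n i)
        then d (holes t a U n) else 0) ∂sixVertexMeasure =
      jumpProb t a * ∫ U, bondRate t (holes t a U n (i + 1)) (holes t a U n i) *
        d (holes t a U n) ∂sixVertexMeasure := by
  set p := jumpProb t a
  have hpt0 : 0 ≤ p * t := by positivity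
  have hpt1 : p * t ≤ 1 := by nlinarith
  let A : (ℕ → Bool) → ℝ := fun ξ => (if ξ i = true ∧ ξ (i + 1) = false then 1 else 0) * d ξ
  let B : (ℕ → Bool) → ℝ := fun ξ => (if ξ i = false ∧ ξ (i + 1) = true then 1 else 0) * d ξ
  have hms : ∀ (j : ℕ) (b : Bool), MeasurableSet {ξ : ℕ → Bool | ξ j = b} := fun j b =>
    measurableSet_eq_fun (measurable_pi_apply j) measurable_const
  have hA : Measurable A := (Measurable.ite ((hms i true).inter (hms (i + 1) false))
    measurable_const measurable_const).mul hd
  have hB : Measurable B := (Measurable.ite ((hms i false).inter (hms (i + 1) true))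
    measurable_const measurable_const).mul hd
  have hAM : ∀ ξ, |A ξ| ≤ M := by
    intro ξ; simp only [A]; split_ifs
    · simpa using hM ξ
    · simpa using (abs_nonneg _).trans (hM ξ)
  have hBM : ∀ ξ, |B ξ| ≤ M := by
    intro ξ; simp only [B]; split_ifs
    · simpa using hM ξ
    · simpa using (abs_nonneg _).trans (hM ξ)
  have hmi : ∀ r : ℝ, Measurable fun U : SixVertexSpace =>
      if (U (bondVertex n i) : ℝ) ≤ r then (1 : ℝ) else 0 := fun r =>
    Measurable.ite (measurableSet_le (measurable_subtype_coe.comp (measurable_pi_apply _))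
      measurable_const) measurable_const measurable_const
  have hint : ∀ (r : ℝ) {k : (ℕ → Bool) → ℝ} (_ : Measurable k) (_ : ∀ ξ, |k ξ| ≤ M),
      Integrable (fun U : SixVertexSpace => (if (U (bondVertex n i) : ℝ) ≤ r then (1 : ℝ) else 0) *
        k (holes t a U n)) sixVertexMeasure := by
    intro r k hk hkM
    refine Integrable.of_bound ((hmi r).mul (hk.comp (measurable_holes t a n))).aestronglyMeasurable
      M (ae_of_all _ fun U => ?_)
    split_ifs
    · simpa using hkM _
    · simpa using (abs_nonneg _).trans (hkM (fun _ => true))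
  have hsplit : (fun U : SixVertexSpace => if (U (bondVertex n i) : ℝ) ≤
        p * bondRate t (holes t a U n (i + 1)) (holes t a U n i)
        then d (holes t a U n) else 0) = fun U : SixVertexSpace =>
      (if (U (bondVertex n i) : ℝ) ≤ p then 1 else 0) * A (holes t a U n) +
      (if (U (bondVertex n i) : ℝ) ≤ p * t then 1 else 0) * B (holes t a U n) := by
    ext U
    generalize holes t a U n = ξ
    have h0' := h0 ξ
    simp only [A, B]
    cases h1 : ξ i <;> cases h2 : ξ (i + 1) <;> simp [bondRate, h1, h2] at h0' ⊢ <;> simp [h0']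
  have hrate : (fun U : SixVertexSpace => bondRate t (holes t a U n (i + 1)) (holes t a U n i) *
        d (holes t a U n)) = fun U => A (holes t a U n) + t * B (holes t a U n) := by
    ext U
    generalize holes t a U n = ξ
    simp only [A, B]
    cases h1 : ξ i <;> cases h2 : ξ (i + 1) <;> simp [bondRate]
  rw [hsplit, hrate]
  refine ⟨(hint _ hA hAM).add (hint _ hB hBM), ?_⟩
  rw [integral_add (hint _ hA hAM) (hint _ hB hBM),
    integral_indicator_le_mul_holes n i hp0 hp1 hA, integral_indicator_le_mul_holes n i hpt0 hpt1 hB,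
    integral_add (integrable_of_bounded_holes hA hAM)
      ((integrable_of_bounded_holes hB hBM).const_mul t), integral_const_mul]
  ring

/-- First-order expansion, in the jump probability, of the evolution over one row. -/
lemma abs_integral_holes_succ_sub_le (ht0 : 0 ≤ t) (ht1 : t < 1) (hp0 : 0 ≤ jumpProb t a)
    (hp1 : jumpProb t a ≤ 1) (n : ℕ) {L : ℕ} {g : (ℕ → Bool) → ℝ} (hg : DependsOn g (Set.Iic L))
    {M : ℝ} (hM : ∀ ξ, |g ξ| ≤ M) :
    |∫ U, g (holes t a U (n + 1)) ∂sixVertexMeasure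
      - ∫ U, g (flipZero (holes t a U n)) ∂sixVertexMeasure
      - jumpProb t a * ∫ U, exchangeGenerator t L g (holes t a U n) ∂sixVertexMeasure|
      ≤ 2 * M * (L + 2) ^ 3 * jumpProb t a ^ 2 := by
  set p := jumpProb t a with hp
  have hM0 : 0 ≤ M := (abs_nonneg _).trans (hM fun _ => true)
  have hgm : Measurable g := hg.measurable_bool (Set.finite_Iic L)
  have hgF : Measurable fun ξ => g (flipZero ξ) := hgm.comp measurable_flipZero
  let d : ℕ → (ℕ → Bool) → ℝ := fun i ξ =>
    g (flipZero (ξ ∘ Equiv.swap i (i + 1))) - g (flipZero ξ)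
  have hd : ∀ i, Measurable (d i) := fun i => by
    refine Measurable.sub (hgF.comp ?_) hgF
    exact measurable_pi_lambda _ fun k => measurable_pi_apply _
  have hdM : ∀ i ξ, |d i ξ| ≤ 2 * M := fun i ξ => by
    have h1 := abs_sub (g (flipZero (ξ ∘ Equiv.swap i (i + 1)))) (g (flipZero ξ))
    have h2 := hM (flipZero (ξ ∘ Equiv.swap i (i + 1)))
    have h3 := hM (flipZero ξ)
    simp only [d]; linarith
  have hd0 : ∀ i ξ, ξ i = ξ (i + 1) → d i ξ = 0 := fun i ξ h => by
    simp only [d]; rw [comp_swap_eq_self h, sub_self]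
  have hex := fun i => integral_exchange ht0 ht1 hp0 hp1 (n := n) (i := i) (hd i) (hdM i) (hd0 i)
  let s : SixVertexSpace → ℕ → ℝ := fun U i => if (U (bondVertex n i) : ℝ) ≤
        p * bondRate t (holes t a U n (i + 1)) (holes t a U n i)
        then d i (holes t a U n) else 0
  have hA : p * ∫ U, exchangeGenerator t L g (holes t a U n) ∂sixVertexMeasure
      = ∫ U, ∑ i ∈ Finset.range (L + 1), s U i ∂sixVertexMeasure := by
    rw [integral_finsetSum _ fun i _ => (hex i).1]
    simp only [exchangeGenerator]
    rw [integral_finsetSum, Finset.mul_sum]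
    · exact Finset.sum_congr rfl fun i _ => (hex i).2.symm
    · intro i _
      refine Integrable.of_bound (C := 2 * M) (Measurable.aestronglyMeasurable ?_)
        (ae_of_all _ fun U => ?_)
      · refine Measurable.mul ?_ ((hd i).comp (measurable_holes t a n))
        have : Measurable fun q : Bool × Bool => bondRate t q.1 q.2 := measurable_of_finite _
        have h1 := fun j => (measurable_pi_apply j).comp (measurable_holes t a n)
        exact this.comp ((h1 (i + 1)).prodMk (h1 i))
      · rw [Real.norm_eq_abs, abs_mul, abs_of_nonneg (bondRate_nonneg ht0 _ _)]
        calc _ ≤ 1 * (2 * M) := mul_le_mul (bondRate_le_one ht1 _ _) (hdM i _) (abs_nonneg _)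
              zero_le_one
          _ = _ := one_mul _
  obtain ⟨hRi, hR⟩ := integral_sum_offDiag_le n (L + 2) hp0 hp1
  set R : SixVertexSpace → ℝ := fun U => ∑ q ∈ (Finset.range (L + 2)).offDiag,
        (if (U (bondVertex n q.1) : ℝ) ≤ p then (1 : ℝ) else 0) *
          (if (U (bondVertex n q.2) : ℝ) ≤ p then 1 else 0) with hRdef
  have hi1 : Integrable (fun U => g (holes t a U (n + 1))) sixVertexMeasure :=
    integrable_of_bounded_holes hgm hM
  have hi2 : Integrable (fun U => g (flipZero (holes t a U n))) sixVertexMeasure :=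
    integrable_of_bounded_holes hgF fun _ => hM _
  have hi3 : Integrable (fun U => ∑ i ∈ Finset.range (L + 1), s U i) sixVertexMeasure :=
    integrable_finsetSum _ fun i _ => (hex i).1
  have hi12 : Integrable (fun U => g (holes t a U (n + 1)) - g (flipZero (holes t a U n)))
      sixVertexMeasure := hi1.sub hi2
  rw [hA, ← integral_sub hi1 hi2, ← integral_sub hi12 hi3]
  have hpt : ∀ U, |g (holes t a U (n + 1)) - g (flipZero (holes t a U n))
      - ∑ i ∈ Finset.range (L + 1), s U i| ≤ 2 * M * (L + 2) * R U := by
    intro U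
    have hterm : ∀ q ∈ (Finset.range (L + 2)).offDiag, 0 ≤
        (if (U (bondVertex n q.1) : ℝ) ≤ p then (1 : ℝ) else 0) *
          (if (U (bondVertex n q.2) : ℝ) ≤ p then 1 else 0) := fun q _ => by
      split_ifs <;> norm_num
    by_cases hV : ∀ i ≤ L + 1, ∀ j ≤ L + 1, (U (bondVertex n i) : ℝ) ≤ p →
        (U (bondVertex n j) : ℝ) ≤ p → i = j
    · rw [eq_add_sum_exchange (V := fun i => (U (bondVertex n i) : ℝ)) ht1 hp0
        (holes_succ_zero t a U n) (holes_update t a U n) hV hg]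
      have : 0 ≤ 2 * M * (L + 2) * R U := mul_nonneg (by positivity) (Finset.sum_nonneg hterm)
      simpa [s, d] using this
    · push Not at hV
      obtain ⟨i, hi, j, hj, hi', hj', hij⟩ := hV
      have h1 : 1 ≤ R U := by
        refine le_trans (le_of_eq ?_) (Finset.single_le_sum hterm (a := (i, j)) (by
          simp [hij]; omega))
        simp [hi', hj']
      have h2 : |∑ i ∈ Finset.range (L + 1), s U i| ≤ (L + 1) * (2 * M) := by
        refine (Finset.abs_sum_le_sum_abs _ _).trans ?_
        calc _ ≤ ∑ _i ∈ Finset.range (L + 1), 2 * M := Finset.sum_le_sum fun i _ => by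
              simp only [s]; split_ifs
              · exact hdM i _
              · simpa using hM0
          _ = _ := by simp
      have h3 := hM (holes t a U (n + 1))
      have h4 := hM (flipZero (holes t a U n))
      have h5 := abs_sub (g (holes t a U (n + 1)) - g (flipZero (holes t a U n)))
        (∑ i ∈ Finset.range (L + 1), s U i)
      have h6 := abs_sub (g (holes t a U (n + 1))) (g (flipZero (holes t a U n)))
      have h7 : 2 * M * (L + 2) * 1 ≤ 2 * M * (L + 2) * R U :=
        mul_le_mul_of_nonneg_left h1 (by positivity)
      linarith
  refine (abs_integral_le_integral_abs).trans
    ((integral_mono ((hi12.sub hi3).abs) (hRi.const_mul (2 * M * (L + 2))) hpt).trans ?_)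
  rw [integral_const_mul]
  calc _ ≤ 2 * M * (L + 2) * (((L + 2 : ℕ) : ℝ) ^ 2 * p ^ 2) :=
        mul_le_mul_of_nonneg_left hR (by positivity)
    _ = _ := by push_cast; ring

/-- Up to the flip of site `0`, one row changes expectations by the order of the jump probability. -/
lemma abs_integral_holes_succ_sub_flipZero_le (ht0 : 0 ≤ t) (ht1 : t < 1) (hp0 : 0 ≤ jumpProb t a)
    (hp1 : jumpProb t a ≤ 1) (n : ℕ) {L : ℕ} {g : (ℕ → Bool) → ℝ} (hg : DependsOn g (Set.Iic L))
    {M : ℝ} (hM : ∀ ξ, |g ξ| ≤ M) :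
    |∫ U, g (holes t a U (n + 1)) ∂sixVertexMeasure
      - ∫ U, g (flipZero (holes t a U n)) ∂sixVertexMeasure|
      ≤ 4 * M * (L + 2) ^ 3 * jumpProb t a := by
  have h1 := abs_integral_holes_succ_sub_le ht0 ht1 hp0 hp1 n hg hM
  have hM0 : 0 ≤ M := (abs_nonneg _).trans (hM fun _ => true)
  have h2 : |∫ U, exchangeGenerator t L g (holes t a U n) ∂sixVertexMeasure|
      ≤ (L + 1) * (2 * M) := by
    refine (abs_integral_le_integral_abs).trans ((integral_mono_of_nonneg
      (ae_of_all _ fun _ => abs_nonneg _) (integrable_const ((L + 1) * (2 * M)))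
      (ae_of_all _ fun U => abs_exchangeGenerator_le ht0 ht1 hM _)).trans ?_)
    simp
  set p := jumpProb t a
  set x := ∫ U, g (holes t a U (n + 1)) ∂sixVertexMeasure
      - ∫ U, g (flipZero (holes t a U n)) ∂sixVertexMeasure
  set y := ∫ U, exchangeGenerator t L g (holes t a U n) ∂sixVertexMeasure
  have h3 : |x| ≤ |x - p * y| + |p * y| := by
    have := abs_add_le (x - p * y) (p * y); rwa [sub_add_cancel] at this
  have h4 : |p * y| ≤ p * ((L + 1) * (2 * M)) := by
    rw [abs_mul, abs_of_nonneg hp0]; gcongr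
  have h5 : p ^ 2 ≤ p := by nlinarith
  have h6 : 2 * M * (L + 2) ^ 3 * p ^ 2 ≤ 2 * M * (L + 2) ^ 3 * p := by gcongr
  have h7 : p * ((L + 1) * (2 * M)) ≤ 2 * M * (L + 2) ^ 3 * p := by
    have : ((L : ℝ) + 1) ≤ (L + 2) ^ 3 := by
      have : (0 : ℝ) ≤ L := Nat.cast_nonneg L
      nlinarith [pow_nonneg this 2, pow_nonneg this 3]
    calc _ = 2 * M * (L + 1) * p := by ring
      _ ≤ _ := by gcongr
  linarith

end OneStep

/-! ### Two rows and the generator of half-line ASEP -/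

/-- The restriction of a configuration on the sites `0, 1, 2, …` to the sites of half-line ASEP. -/
def asepSites (ξ : ℕ → Bool) : ASEPConfig := fun i => ξ i

lemma asepSites_flipZero (ξ : ℕ → Bool) : asepSites (flipZero ξ) = asepSites ξ := by
  ext i; simp [asepSites, flipZero]

/-- Functions of the sites `1, …, L` bounded by `1`. -/
structure IsLocalObservable (L : ℕ) (f : ASEPConfig → ℝ) : Prop where
  dependsOn : DependsOn f {i : ℕ+ | (i : ℕ) ≤ L}
  abs_le : ∀ η, |f η| ≤ 1

lemma finite_pnat_le (L : ℕ) : {i : ℕ+ | (i : ℕ) ≤ L}.Finite :=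
  (Set.finite_Iic L).preimage PNat.coe_injective.injOn

section Generator

variable {t : ℝ} {L : ℕ} {f : ASEPConfig → ℝ}

lemma asepGenerator_eq_sum (hf : DependsOn f {i : ℕ+ | (i : ℕ) ≤ L}) (η : ASEPConfig) :
    asepGenerator 1 t (1 / 2) (t / 2) f η =
      (if η 1 = true then t / 2 else 1 / 2) * (f (Function.update η 1 (!(η 1))) - f η) +
      ∑ k ∈ Finset.range L, bondRate t (η (k.succPNat + 1)) (η k.succPNat) *
        (f (η ∘ Equiv.swap k.succPNat (k.succPNat + 1)) - f η) := by
  rw [asepGenerator]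
  congr 1
  have hinj : Function.Injective Nat.succPNat := Nat.succPNat_injective
  rw [tsum_eq_sum (s := (Finset.range L).map ⟨Nat.succPNat, hinj⟩), Finset.sum_map]
  · simp [bondRate]
  · intro x hx
    have hxL : L < (x : ℕ) := by
      by_contra h
      refine hx (Finset.mem_map.2 ⟨x.natPred, Finset.mem_range.2 ?_, ?_⟩)
      · have := x.pos; simp only [PNat.natPred]; omega
      · simp
    have : f (η ∘ Equiv.swap x (x + 1)) = f η := by
      refine hf fun i hi => ?_
      have hi' : (i : ℕ) ≤ L := hi
      have h1 : i ≠ x := by rintro rfl; omega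
      have h2 : i ≠ x + 1 := by rintro rfl; simp at hi'; omega
      simp [Equiv.swap_apply_of_ne_of_ne h1 h2]
    rw [this, sub_self, mul_zero]

lemma asepGenerator_dependsOn (hf : DependsOn f {i : ℕ+ | (i : ℕ) ≤ L}) :
    DependsOn (asepGenerator 1 t (1 / 2) (t / 2) f) {i : ℕ+ | (i : ℕ) ≤ L + 1} := by
  have hsub : {i : ℕ+ | (i : ℕ) ≤ L} ⊆ {i : ℕ+ | (i : ℕ) ≤ L + 1} := fun i hi => by
    have hi' : (i : ℕ) ≤ L := hi
    exact Set.mem_ofPred.2 (by omega)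
  intro η η' h
  have h1 : η 1 = η' 1 := h 1 (by simp)
  have h2 : f η = f η' := hf fun i hi => h i (hsub hi)
  have h3 : f (Function.update η 1 (!(η 1))) = f (Function.update η' 1 (!(η' 1))) := by
    refine hf fun i hi => ?_
    by_cases hi1 : i = 1
    · subst hi1; simp [h1]
    · simp [hi1, h i (hsub hi)]
  rw [asepGenerator_eq_sum hf, asepGenerator_eq_sum hf, h3, h1, h2]
  congr 1
  refine Finset.sum_congr rfl fun k hk => ?_
  have hk' := Finset.mem_range.1 hk
  have m1 : k.succPNat ∈ {i : ℕ+ | (i : ℕ) ≤ L + 1} := by simp; omega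
  have m2 : k.succPNat + 1 ∈ {i : ℕ+ | (i : ℕ) ≤ L + 1} := by simp; omega
  have h4 : f (η ∘ Equiv.swap k.succPNat (k.succPNat + 1))
      = f (η' ∘ Equiv.swap k.succPNat (k.succPNat + 1)) := hf.comp_swap hsub m1 m2 h
  rw [h _ m1, h _ m2, h4]

lemma abs_asepGenerator_le (ht0 : 0 ≤ t) (ht1 : t < 1) (hf : IsLocalObservable L f)
    (η : ASEPConfig) : |asepGenerator 1 t (1 / 2) (t / 2) f η| ≤ 2 * (L + 1) := by
  have hd : ∀ η', |f η' - f η| ≤ 2 := fun η' => by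
    have h1 := abs_sub (f η') (f η)
    have h2 := hf.abs_le η'
    have h3 := hf.abs_le η
    linarith
  rw [asepGenerator_eq_sum hf.dependsOn]
  refine (abs_add_le _ _).trans ?_
  have h1 : |(if η 1 = true then t / 2 else 1 / 2) * (f (Function.update η 1 (!(η 1))) - f η)|
      ≤ 1 / 2 * 2 := by
    rw [abs_mul]
    refine mul_le_mul ?_ (hd _) (abs_nonneg _) (by norm_num)
    split_ifs
    · rw [abs_of_nonneg (by linarith)]; linarith
    · norm_num
  have h2 : |∑ k ∈ Finset.range L, bondRate t (η (k.succPNat + 1)) (η k.succPNat) *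
        (f (η ∘ Equiv.swap k.succPNat (k.succPNat + 1)) - f η)| ≤ ∑ _k ∈ Finset.range L, (2 : ℝ) := by
    refine (Finset.abs_sum_le_sum_abs _ _).trans (Finset.sum_le_sum fun k _ => ?_)
    rw [abs_mul, abs_of_nonneg (bondRate_nonneg ht0 _ _)]
    calc _ ≤ 1 * (2 : ℝ) := mul_le_mul (bondRate_le_one ht1 _ _) (hd _) (abs_nonneg _) zero_le_one
      _ = 2 := one_mul _
  simp only [Finset.sum_const, Finset.card_range, nsmul_eq_mul] at h2
  linarith

/-- The class of local observables is stable under the generator, up to normalization. The linear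
growth of the norming constant is what limits the comparison of the two dynamics to short times. -/
lemma IsLocalObservable.asepGenerator (ht0 : 0 ≤ t) (ht1 : t < 1) (hf : IsLocalObservable L f) :
    IsLocalObservable (L + 1)
      (fun η => (2 * ((L : ℝ) + 1))⁻¹ * asepGenerator 1 t (1 / 2) (t / 2) f η) where
  dependsOn := fun η η' h => by
    simp only
    rw [asepGenerator_dependsOn (L := L) hf.dependsOn (by exact_mod_cast h)]
  abs_le η := by
    have h0 : (0 : ℝ) < 2 * (L + 1) := by positivity
    rw [abs_mul, abs_of_pos (inv_pos.2 h0), inv_mul_le_iff₀ h0, mul_one]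
    exact abs_asepGenerator_le ht0 ht1 hf η

/-- Site `0` is flipped in every row, so that over two rows an exchange with site `0` has the effect of
a creation with rate `1` and an annihilation with rate `t`. -/
lemma exchangeGenerator_add_flipZero (hf : DependsOn f {i : ℕ+ | (i : ℕ) ≤ L}) (ξ : ℕ → Bool) :
    exchangeGenerator t L (fun ξ => f (asepSites ξ)) ξ +
      exchangeGenerator t L (fun ξ => f (asepSites ξ)) (flipZero ξ) =
      2 * asepGenerator 1 t (1 / 2) (t / 2) f (asepSites ξ) := by
  have hS : ∀ (ξ : ℕ → Bool) (k : ℕ), asepSites (ξ ∘ Equiv.swap (k + 1) (k + 1 + 1)) =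
      asepSites ξ ∘ Equiv.swap k.succPNat (k.succPNat + 1) := fun ξ k => by
    ext i
    simp only [asepSites, Function.comp_apply, Equiv.swap_apply_def]
    have e1 : i = k.succPNat ↔ (i : ℕ) = k + 1 := by rw [← PNat.coe_inj]; simp
    have e2 : i = k.succPNat + 1 ↔ (i : ℕ) = k + 1 + 1 := by rw [← PNat.coe_inj]; simp
    simp only [e1, e2]
    split_ifs <;> simp
  have hS0 : ∀ ξ : ℕ → Bool, asepSites (ξ ∘ Equiv.swap 0 (0 + 1)) =
      Function.update (asepSites ξ) 1 (ξ 0) := fun ξ => by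
    ext i
    by_cases h : i = 1
    · subst h; simp [asepSites]
    · have h1 : (i : ℕ) ≠ 1 := fun h' => h (PNat.coe_eq_one_iff.1 h')
      simp [asepSites, h, Equiv.swap_apply_of_ne_of_ne i.ne_zero h1]
  have hk : ∀ k : ℕ, flipZero ξ (k + 1) = ξ (k + 1) := fun k => by simp [flipZero]
  have hz : flipZero ξ 0 = !ξ 0 := by simp [flipZero]
  have hp1 : ∀ k : ℕ, asepSites ξ k.succPNat = ξ (k + 1) := fun k => rfl
  have hp2 : ∀ k : ℕ, asepSites ξ (k.succPNat + 1) = ξ (k + 1 + 1) := fun k => rfl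
  rw [asepGenerator_eq_sum hf, exchangeGenerator, exchangeGenerator, Finset.sum_range_succ',
    Finset.sum_range_succ']
  simp only [asepSites_flipZero, hS, hS0, hk, hz, hp1, hp2]
  have h1 : asepSites ξ 1 = ξ 1 := rfl
  have hup : ∀ b, ξ 1 = b → Function.update (asepSites ξ) 1 b = asepSites ξ := fun b hb => by
    rw [← hb, ← h1, Function.update_eq_self]
  rw [h1, mul_add]
  have : ∀ x y u v : ℝ, u + v = y → x + u + (x + v) = y + 2 * x := fun x y u v h => by
    rw [← h]; ring
  apply this
  rw [zero_add]
  cases h0 : ξ 0 <;> cases h2 : ξ 1 <;> simp [bondRate, hup _ h2] <;> ring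

end Generator

section TwoSteps

variable {t a : ℝ} {L : ℕ} {f : ASEPConfig → ℝ}

/-- Expectation of an observable of the holes of row `n`. -/
noncomputable def holesMean (t a : ℝ) (f : ASEPConfig → ℝ) (n : ℕ) : ℝ :=
  ∫ U, f (asepSites (holes t a U n)) ∂sixVertexMeasure

lemma DependsOn.comp_asepSites {S : Set ℕ+} (hf : DependsOn f S) :
    DependsOn (fun ξ => f (asepSites ξ)) ((↑) '' S) :=
  fun _ _ h => hf fun i hi => h i (Set.mem_image_of_mem _ hi)

lemma IsLocalObservable.comp_asepSites (hf : IsLocalObservable L f) :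
    DependsOn (fun ξ => f (asepSites ξ)) (Set.Iic L) :=
  hf.dependsOn.comp_asepSites.mono (by rintro _ ⟨i, hi, rfl⟩; exact hi)

lemma add_two_pow_three_le (L : ℕ) : ((L : ℝ) + 2) ^ 3 ≤ ((L : ℝ) + 3) ^ 4 := by
  have hL : (0 : ℝ) ≤ L := Nat.cast_nonneg L
  have h1 : ((L : ℝ) + 2) ^ 3 ≤ ((L : ℝ) + 3) ^ 3 := pow_le_pow_left₀ (by linarith) (by linarith) 3
  exact h1.trans (pow_le_pow_right₀ (by linarith) (by norm_num))

lemma abs_holesMean_succ_sub_le (ht0 : 0 ≤ t) (ht1 : t < 1) (hp0 : 0 ≤ jumpProb t a)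
    (hp1 : jumpProb t a ≤ 1) (n : ℕ) (hf : IsLocalObservable L f) :
    |holesMean t a f (n + 1) - holesMean t a f n| ≤ 4 * (L + 2) ^ 3 * jumpProb t a := by
  have := abs_integral_holes_succ_sub_flipZero_le ht0 ht1 hp0 hp1 n hf.comp_asepSites
    (fun _ => hf.abs_le _)
  simpa only [asepSites_flipZero, mul_one, holesMean] using this

/-- Two consecutive rows reproduce the generator of half-line ASEP, whatever the parity of the
first. -/
lemma abs_holesMean_add_two_sub_le (ht0 : 0 ≤ t) (ht1 : t < 1) (hp0 : 0 ≤ jumpProb t a)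
    (hp1 : jumpProb t a ≤ 1) (n : ℕ) (hf : IsLocalObservable L f) :
    |holesMean t a f (n + 2) - holesMean t a f n -
      2 * (jumpProb t a * holesMean t a (asepGenerator 1 t (1 / 2) (t / 2) f) n)|
      ≤ 12 * (L + 3) ^ 4 * jumpProb t a ^ 2 := by
  set g : (ℕ → Bool) → ℝ := fun ξ => f (asepSites ξ) with hg
  have hgd : DependsOn g (Set.Iic L) := hf.comp_asepSites
  have hM : ∀ ξ, |g ξ| ≤ 1 := fun _ => hf.abs_le _
  have h1 := abs_integral_holes_succ_sub_le ht0 ht1 hp0 hp1 n hgd hM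
  have h2 := abs_integral_holes_succ_sub_le ht0 ht1 hp0 hp1 (n + 1) hgd hM
  have hAM : ∀ ξ, |exchangeGenerator t L g ξ| ≤ (L + 1) * (2 * 1) :=
    abs_exchangeGenerator_le ht0 ht1 hM
  have hAd := exchangeGenerator_dependsOn t hgd
  have hAm : Measurable (exchangeGenerator t L g) := hAd.measurable_bool (Set.finite_Iic _)
  have h3 := abs_integral_holes_succ_sub_flipZero_le ht0 ht1 hp0 hp1 n (L := L + 1)
    (by exact_mod_cast hAd) hAM
  have e : ∫ U, exchangeGenerator t L g (holes t a U n) ∂sixVertexMeasure +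
      ∫ U, exchangeGenerator t L g (flipZero (holes t a U n)) ∂sixVertexMeasure
      = 2 * holesMean t a (asepGenerator 1 t (1 / 2) (t / 2) f) n := by
    rw [holesMean, ← integral_const_mul, ← integral_add (integrable_of_bounded_holes hAm hAM)
      (integrable_of_bounded_holes (k := fun ξ => exchangeGenerator t L g (flipZero ξ))
        (hAm.comp measurable_flipZero) (fun ξ => hAM _))]
    exact integral_congr_ae (ae_of_all _ fun U => exchangeGenerator_add_flipZero hf.dependsOn _)
  have e0 : ∀ m, ∫ U, g (holes t a U m) ∂sixVertexMeasure = holesMean t a f m := fun m => rfl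
  have e1 : ∀ m, ∫ U, g (flipZero (holes t a U m)) ∂sixVertexMeasure = holesMean t a f m :=
    fun m => by simp only [hg, asepSites_flipZero]; rfl
  rw [e0, e1] at h1 h2
  set p := jumpProb t a
  set G0 := holesMean t a f n
  set G1 := holesMean t a f (n + 1)
  have e2 : n + 1 + 1 = n + 2 := rfl
  rw [e2] at h2
  set G2 := holesMean t a f (n + 2)
  set A0 := ∫ U, exchangeGenerator t L g (holes t a U n) ∂sixVertexMeasure
  set A0' := ∫ U, exchangeGenerator t L g (flipZero (holes t a U n)) ∂sixVertexMeasure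
  set A1 := ∫ U, exchangeGenerator t L g (holes t a U (n + 1)) ∂sixVertexMeasure
  have e3 : G2 - G0 - 2 * (p * holesMean t a (asepGenerator 1 t (1 / 2) (t / 2) f) n)
      = (G2 - G1 - p * A1) + (G1 - G0 - p * A0) + p * (A1 - A0') := by
    have : 2 * (p * holesMean t a (asepGenerator 1 t (1 / 2) (t / 2) f) n) = p * (A0 + A0') := by
      rw [e]; ring
    rw [this]; ring
  rw [e3]
  have h4 : |p * (A1 - A0')| ≤ p * (4 * ((L + 1) * (2 * 1)) * ((L + 1 : ℕ) + 2) ^ 3 * p) := by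
    rw [abs_mul, abs_of_nonneg hp0]; gcongr
  have h5 := abs_add_three (G2 - G1 - p * A1) (G1 - G0 - p * A0) (p * (A1 - A0'))
  have hL : (0 : ℝ) ≤ L := Nat.cast_nonneg L
  have h6 : 2 * 1 * ((L : ℝ) + 2) ^ 3 * p ^ 2 ≤ 2 * (L + 3) ^ 4 * p ^ 2 := by
    have := add_two_pow_three_le L
    calc _ = 2 * ((L : ℝ) + 2) ^ 3 * p ^ 2 := by ring
      _ ≤ _ := by gcongr
  have h7 : p * (4 * (((L : ℝ) + 1) * (2 * 1)) * ((L + 1 : ℕ) + 2) ^ 3 * p)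
      ≤ 8 * (L + 3) ^ 4 * p ^ 2 := by
    push_cast
    calc _ = 8 * (((L : ℝ) + 1) * (L + 3) ^ 3) * p ^ 2 := by ring
      _ ≤ 8 * (((L : ℝ) + 3) * (L + 3) ^ 3) * p ^ 2 := by gcongr; norm_num
      _ = _ := by ring
  linarith

/-- Discrete Kolmogorov equation of the six-vertex model, up to small errors. -/
lemma abs_holesMean_sub_sum_le (ht0 : 0 ≤ t) (ht1 : t < 1) (hp0 : 0 ≤ jumpProb t a)
    (hp1 : jumpProb t a ≤ 1) (n m : ℕ) (hf : IsLocalObservable L f) :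
    |holesMean t a f (n + m) - holesMean t a f n - jumpProb t a *
      ∑ j ∈ Finset.range m, holesMean t a (asepGenerator 1 t (1 / 2) (t / 2) f) (n + j)|
      ≤ 6 * (L + 3) ^ 4 * (jumpProb t a + m * jumpProb t a ^ 2) := by
  set p := jumpProb t a
  set G := holesMean t a f
  set H := holesMean t a (asepGenerator 1 t (1 / 2) (t / 2) f)
  have hL : (0 : ℝ) ≤ L := Nat.cast_nonneg L
  have htel : ∀ m : ℕ, |G (n + m + 1) + G (n + m) - (G (n + 1) + G n) -
      2 * (p * ∑ j ∈ Finset.range m, H (n + j))| ≤ 12 * (L + 3) ^ 4 * (m * p ^ 2) := by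
    intro m
    induction m with
    | zero => simp
    | succ m ih =>
      have h := abs_holesMean_add_two_sub_le ht0 ht1 hp0 hp1 (n + m) hf
      rw [Finset.sum_range_succ]
      have e : G (n + (m + 1) + 1) + G (n + (m + 1)) - (G (n + 1) + G n) -
          2 * (p * (∑ j ∈ Finset.range m, H (n + j) + H (n + m)))
          = (G (n + m + 1) + G (n + m) - (G (n + 1) + G n) -
            2 * (p * ∑ j ∈ Finset.range m, H (n + j))) +
            (G (n + m + 2) - G (n + m) - 2 * (p * H (n + m))) := by
        rw [← add_assoc]; ring
      rw [e]
      refine (abs_add_le _ _).trans ((add_le_add ih h).trans (le_of_eq ?_))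
      push_cast; ring
  have h0 := htel m
  have h1 := abs_holesMean_succ_sub_le ht0 ht1 hp0 hp1 n hf
  have h2 := abs_holesMean_succ_sub_le ht0 ht1 hp0 hp1 (n + m) hf
  have h3 : 4 * ((L : ℝ) + 2) ^ 3 * p ≤ 6 * (L + 3) ^ 4 * p := by
    have := add_two_pow_three_le L
    gcongr
    norm_num
  have e : G (n + m) - G n - p * ∑ j ∈ Finset.range m, H (n + j) =
      2⁻¹ * ((G (n + m + 1) + G (n + m) - (G (n + 1) + G n) -
      2 * (p * ∑ j ∈ Finset.range m, H (n + j))) - (G (n + m + 1) - G (n + m))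
        + (G (n + 1) - G n)) := by ring
  rw [e, abs_mul, abs_of_pos (by norm_num : (0 : ℝ) < 2⁻¹)]
  have h4 := abs_add_le ((G (n + m + 1) + G (n + m) - (G (n + 1) + G n) -
      2 * (p * ∑ j ∈ Finset.range m, H (n + j))) - (G (n + m + 1) - G (n + m))) (G (n + 1) - G n)
  have h5 := abs_sub (G (n + m + 1) + G (n + m) - (G (n + 1) + G n) -
      2 * (p * ∑ j ∈ Finset.range m, H (n + j))) (G (n + m + 1) - G (n + m))
  change |G (n + 1) - G n| ≤ _ at h1
  change |G (n + m + 1) - G (n + m)| ≤ _ at h2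
  have h6 : 6 * ((L : ℝ) + 3) ^ 4 * (p + m * p ^ 2) =
    6 * (L + 3) ^ 4 * p + 6 * (L + 3) ^ 4 * (m * p ^ 2) := by ring
  rw [h6]
  linarith

end TwoSteps

/-! ### The Kolmogorov equation of half-line ASEP -/

section ASEP

variable {Ω : Type*} {mΩ : MeasurableSpace Ω} {μ : Measure Ω} {𝓕 : Filtration ℝ≥0 mΩ}
  {η : ℝ≥0 → Ω → ASEPConfig}

/-- Expectation of an observable of the process `η` at time `s`. -/
noncomputable def asepMean (μ : Measure Ω) (η : ℝ≥0 → Ω → ASEPConfig) (f : ASEPConfig → ℝ) (s : ℝ) :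
    ℝ :=
  ∫ ω, f (η s.toNNReal ω) ∂μ

/-- A right-continuous process is jointly measurable, as the limit of its discretizations from the
right. -/
lemma measurable_uncurry_of_rightContinuous {X : ℝ≥0 → Ω → ℝ} (hX : ∀ s, Measurable (X s))
    (hc : ∀ ω s, ContinuousWithinAt (fun r => X r ω) (Set.Ici s) s) :
    Measurable (Function.uncurry X) := by
  let d : ℕ → ℝ≥0 → ℝ≥0 := fun n r => (⌊r * (n + 1)⌋₊ + 1) / (n + 1)
  have hd : ∀ r, Tendsto (fun n => d n r) atTop (𝓝[≥] r) := by
    intro r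
    have hge : ∀ n, r ≤ d n r := fun n => by
      rw [le_div_iff₀ (by positivity)]
      exact (Nat.lt_floor_add_one _).le
    have hle : ∀ n : ℕ, d n r ≤ r + 1 / (n + 1) := fun n => by
      have hn : (0 : ℝ≥0) < (n : ℝ≥0) + 1 := by positivity
      rw [div_le_iff₀ hn, add_mul, one_div_mul_cancel hn.ne']
      gcongr
      exact Nat.floor_le (by positivity)
    refine tendsto_nhdsWithin_iff.2 ⟨?_, Eventually.of_forall hge⟩
    refine tendsto_of_tendsto_of_tendsto_of_le_of_le tendsto_const_nhds ?_ hge hle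
    have : Tendsto (fun n : ℕ => r + 1 / ((n : ℝ≥0) + 1)) atTop (𝓝 (r + 0)) :=
      tendsto_const_nhds.add tendsto_one_div_add_atTop_nhds_zero_nat
    simpa using this
  refine measurable_of_tendsto_metrizable (f := fun n q => X (d n q.1) q.2) (fun n => ?_) ?_
  · have h1 : Measurable fun q : ℕ × Ω => X (((q.1 : ℝ≥0) + 1) / (n + 1)) q.2 :=
      measurable_from_prod_countable_right fun k => hX (((k : ℝ≥0) + 1) / (n + 1))
    have h2 : Measurable fun q : ℝ≥0 × Ω => (⌊q.1 * (n + 1)⌋₊, q.2) :=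
      (Nat.measurable_floor.comp (measurable_fst.mul_const _)).prodMk measurable_snd
    have h3 := h1.comp h2
    simpa only [Function.comp_def, d] using h3
  · refine tendsto_pi_nhds.2 fun q => ?_
    exact (hc q.2 q.1).tendsto.comp (hd q.1)

variable {p q α γ : ℝ}

namespace IsHalfLineASEP

lemma measurable_config (hη : IsHalfLineASEP p q α γ μ 𝓕 η) (s : ℝ≥0) : Measurable (η s) :=
  (hη.measurable s).mono (𝓕.le s) le_rfl

lemma measurable_observable (hη : IsHalfLineASEP p q α γ μ 𝓕 η) {f : ASEPConfig → ℝ}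
    {S : Set ℕ+} (hS : S.Finite) (hf : DependsOn f S) :
    Measurable fun r : ℝ × Ω => f (η r.1.toNNReal r.2) := by
  have h := measurable_uncurry_of_rightContinuous (X := fun s ω => f (η s ω))
    (fun s => (hf.measurable_bool hS).comp (hη.measurable_config s))
    (fun ω s => (hf.continuous_bool hS).continuousAt.comp_continuousWithinAt
      (hη.right_continuous ω s))
  exact h.comp ((measurable_real_toNNReal.comp measurable_fst).prodMk measurable_snd)

variable [IsProbabilityMeasure μ]

/-- Kolmogorov's forward equation for half-line ASEP. -/
lemma asepMean_sub_eq_integral (hη : IsHalfLineASEP p q α γ μ 𝓕 η) {f : ASEPConfig → ℝ}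
    {S T : Finset ℕ+} (hf : DependsOn f (S : Set ℕ+)) {M M' : ℝ} (hM : ∀ ξ, |f ξ| ≤ M)
    (hLf : DependsOn (asepGenerator p q α γ f) (T : Set ℕ+))
    (hM' : ∀ ξ, |asepGenerator p q α γ f ξ| ≤ M') {s : ℝ} (hs : 0 ≤ s) :
    asepMean μ η f s - asepMean μ η f 0 =
      ∫ r in (0 : ℝ)..s, asepMean μ η (asepGenerator p q α γ f) r := by
  have h := (hη.martingale f S hf).setIntegral_eq (zero_le (a := s.toNNReal)) MeasurableSet.univ
  have hint : ∀ s, Integrable (fun ω => f (η s ω)) μ := fun s =>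
    Integrable.of_bound ((hf.measurable_bool S.finite_toSet).comp
      (hη.measurable_config s)).aestronglyMeasurable M (ae_of_all _ fun _ => hM _)
  have hjm := hη.measurable_observable T.finite_toSet hLf
  have : IsFiniteMeasure (volume.restrict (Set.uIoc 0 s)) := by
    rw [Set.uIoc_of_le hs]; infer_instance
  have hprod : Integrable (Function.uncurry fun (r : ℝ) (ω : Ω) =>
      asepGenerator p q α γ f (η r.toNNReal ω)) ((volume.restrict (Set.uIoc 0 s)).prod μ) :=
    Integrable.of_bound hjm.aestronglyMeasurable M' (ae_of_all _ fun _ => hM' _)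
  have hswap := intervalIntegral_integral_swap hprod
  have hprod' : Integrable (fun ω => ∫ r in (0 : ℝ)..s,
      asepGenerator p q α γ f (η r.toNNReal ω)) μ := by
    simp only [intervalIntegral.integral_of_le hs]
    rw [Set.uIoc_of_le hs] at hprod
    exact hprod.integral_prod_right
  simp only [Measure.restrict_univ, Real.coe_toNNReal _ hs, NNReal.coe_zero,
    intervalIntegral.integral_same, sub_self, integral_zero] at h
  have hint2 : Integrable (fun ω => f (η s.toNNReal ω) - f (η 0 ω)) μ := (hint _).sub (hint _)
  rw [integral_sub hint2 hprod', integral_sub (hint _) (hint _)] at h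
  simp only [asepMean, Real.toNNReal_zero]
  rw [hswap]
  linarith

variable {t : ℝ} {L : ℕ} {f : ASEPConfig → ℝ}

lemma asepMean_sub_eq (hη : IsHalfLineASEP 1 t (1 / 2) (t / 2) μ 𝓕 η) (ht0 : 0 ≤ t) (ht1 : t < 1)
    (hf : IsLocalObservable L f) {r s : ℝ} (hr : 0 ≤ r) (hrs : r ≤ s) :
    IntervalIntegrable (asepMean μ η (asepGenerator 1 t (1 / 2) (t / 2) f)) volume r s ∧
    asepMean μ η f s - asepMean μ η f r =
      ∫ u in r..s, asepMean μ η (asepGenerator 1 t (1 / 2) (t / 2) f) u := by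
  have hS := finite_pnat_le L
  have hT := finite_pnat_le (L + 1)
  have hLf := asepGenerator_dependsOn (t := t) hf.dependsOn
  have hTd : DependsOn (asepGenerator 1 t (1 / 2) (t / 2) f) (hT.toFinset : Set ℕ+) := by
    rw [hT.coe_toFinset]; exact_mod_cast hLf
  have hM' := abs_asepGenerator_le ht0 ht1 hf
  have h := fun {s : ℝ} (hs : 0 ≤ s) => hη.asepMean_sub_eq_integral (S := hS.toFinset)
    (T := hT.toFinset) (by rw [hS.coe_toFinset]; exact hf.dependsOn) hf.abs_le hTd hM' hs
  have hint : ∀ x y : ℝ, IntervalIntegrable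
      (asepMean μ η (asepGenerator 1 t (1 / 2) (t / 2) f)) volume x y := by
    intro x y
    have hm := (hη.measurable_observable hT.toFinset.finite_toSet hTd).stronglyMeasurable
    have hm' : StronglyMeasurable (asepMean μ η (asepGenerator 1 t (1 / 2) (t / 2) f)) :=
      hm.integral_prod_right
    have : IsFiniteMeasure (volume.restrict (Set.uIoc x y)) := by
      unfold Set.uIoc; infer_instance
    rw [intervalIntegrable_iff]
    refine Integrable.of_bound hm'.aestronglyMeasurable (2 * (L + 1)) (ae_of_all _ fun u => ?_)
    refine (abs_integral_le_integral_abs).trans ((integral_mono_of_nonneg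
      (ae_of_all _ fun _ => abs_nonneg _) (integrable_const (2 * ((L : ℝ) + 1)))
      (ae_of_all _ fun ω => hM' _)).trans ?_)
    simp
  refine ⟨hint _ _, ?_⟩
  rw [← intervalIntegral.integral_interval_sub_left (hint 0 s) (hint 0 r), ← h hr,
    ← h (hr.trans hrs)]
  ring

lemma abs_asepMean_sub_le (hη : IsHalfLineASEP 1 t (1 / 2) (t / 2) μ 𝓕 η) (ht0 : 0 ≤ t)
    (ht1 : t < 1) (hf : IsLocalObservable L f) {r s : ℝ} (hr : 0 ≤ r) (hrs : r ≤ s) :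
    |asepMean μ η f s - asepMean μ η f r| ≤ 2 * (L + 1) * (s - r) := by
  rw [(hη.asepMean_sub_eq ht0 ht1 hf hr hrs).2, ← abs_of_nonneg (sub_nonneg.2 hrs)]
  refine intervalIntegral.norm_integral_le_of_norm_le_const (E := ℝ) fun u _ => ?_
  refine (abs_integral_le_integral_abs).trans ((integral_mono_of_nonneg
    (ae_of_all _ fun _ => abs_nonneg _) (integrable_const (2 * ((L : ℝ) + 1)))
    (ae_of_all _ fun ω => abs_asepGenerator_le ht0 ht1 hf _)).trans ?_)
  simp

/-- Second-order expansion in time: the generator maps local observables to multiples of local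
observables, whose expectations are Lipschitz. -/
lemma abs_asepMean_sub_sub_le (hη : IsHalfLineASEP 1 t (1 / 2) (t / 2) μ 𝓕 η) (ht0 : 0 ≤ t)
    (ht1 : t < 1) (hf : IsLocalObservable L f) {r s : ℝ} (hr : 0 ≤ r) (hrs : r ≤ s) :
    |asepMean μ η f s - asepMean μ η f r
      - (s - r) * asepMean μ η (asepGenerator 1 t (1 / 2) (t / 2) f) r|
      ≤ 4 * (L + 2) ^ 2 * (s - r) ^ 2 := by
  set H := asepMean μ η (asepGenerator 1 t (1 / 2) (t / 2) f) with hH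
  have hL : (0 : ℝ) < 2 * (L + 1) := by positivity
  have hLip : ∀ u, r ≤ u → |H u - H r| ≤ 4 * (L + 2) ^ 2 * (u - r) := by
    intro u hu
    have h1 := abs_asepMean_sub_le hη ht0 ht1 (hf.asepGenerator ht0 ht1) hr hu
    simp only [asepMean, integral_const_mul] at h1
    rw [← mul_sub, abs_mul, abs_of_pos (inv_pos.2 hL), inv_mul_le_iff₀ hL] at h1
    refine h1.trans ?_
    push_cast
    have h3 : (0 : ℝ) ≤ u - r := by linarith
    calc _ = 4 * (((L : ℝ) + 1) * (L + 2)) * (u - r) := by ring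
      _ ≤ 4 * (((L : ℝ) + 2) * (L + 2)) * (u - r) := by gcongr; norm_num
      _ = _ := by ring
  obtain ⟨hi, h⟩ := hη.asepMean_sub_eq ht0 ht1 hf hr hrs
  have hconst : ∫ _u in r..s, H r = (s - r) * H r := by simp
  rw [h, ← hconst, ← intervalIntegral.integral_sub hi intervalIntegrable_const]
  have h2 := intervalIntegral.norm_integral_le_of_norm_le_const (a := r) (b := s)
    (f := fun u => H u - H r) (C := 4 * (L + 2) ^ 2 * (s - r)) (fun u hu => by
      rw [Set.uIoc_of_le hrs] at hu
      refine (hLip u hu.1.le).trans ?_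
      have := hu.2
      gcongr)
  rw [abs_of_nonneg (sub_nonneg.2 hrs)] at h2
  refine h2.trans (le_of_eq (by ring))

/-- Discretized Kolmogorov equation of half-line ASEP. -/
lemma abs_asepMean_sub_sum_le (hη : IsHalfLineASEP 1 t (1 / 2) (t / 2) μ 𝓕 η) (ht0 : 0 ≤ t)
    (ht1 : t < 1) (hf : IsLocalObservable L f) {ε : ℝ} (hε : 0 ≤ ε) (n m : ℕ) :
    |asepMean μ η f ((n + m : ℕ) * ε) - asepMean μ η f (n * ε) - ε * ∑ j ∈ Finset.range m,
      asepMean μ η (asepGenerator 1 t (1 / 2) (t / 2) f) ((n + j : ℕ) * ε)|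
      ≤ 4 * (L + 2) ^ 2 * (m * ε ^ 2) := by
  induction m with
  | zero => simp
  | succ m ih =>
    have h := hη.abs_asepMean_sub_sub_le ht0 ht1 hf (r := (n + m : ℕ) * ε)
      (s := (n + (m + 1) : ℕ) * ε) (by positivity) (by gcongr; omega)
    have e : ((n + (m + 1) : ℕ) : ℝ) * ε - (n + m : ℕ) * ε = ε := by push_cast; ring
    rw [e] at h
    rw [Finset.sum_range_succ]
    set F := asepMean μ η f
    set H := asepMean μ η (asepGenerator 1 t (1 / 2) (t / 2) f)
    have e2 : F ((n + (m + 1) : ℕ) * ε) - F (n * ε) -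
        ε * (∑ j ∈ Finset.range m, H ((n + j : ℕ) * ε) + H ((n + m : ℕ) * ε)) =
        (F ((n + m : ℕ) * ε) - F (n * ε) - ε * ∑ j ∈ Finset.range m, H ((n + j : ℕ) * ε)) +
        (F ((n + (m + 1) : ℕ) * ε) - F ((n + m : ℕ) * ε) - ε * H ((n + m : ℕ) * ε)) := by ring
    rw [e2]
    refine (abs_add_le _ _).trans ((add_le_add ih h).trans (le_of_eq ?_))
    push_cast; ring

end IsHalfLineASEP

end ASEP

/-! ### Comparison of the two dynamics on local observables -/

section Scaling

variable {t : ℝ}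

/-- The vertex parameter at scale `ε`. -/
noncomputable def scaledParam (t ε : ℝ) : ℝ := 1 - (1 - t) * ε / 2

lemma jumpProb_scaledParam (ht0 : 0 ≤ t) (ht1 : t < 1) {ε : ℝ} (hε : 0 ≤ ε) (hε1 : ε ≤ 1) :
    0 ≤ jumpProb t (scaledParam t ε) ∧ jumpProb t (scaledParam t ε) ≤ ε ∧
      |jumpProb t (scaledParam t ε) - ε| ≤ 2 * ε ^ 2 := by
  have h1t : 0 < 1 - t := by linarith
  -- with `b` the square of the parameter and `v = (1 - b) / (1 - t)`, the probability is `v / (1 + t v)`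
  set v : ℝ := ε - (1 - t) * ε ^ 2 / 4 with hv
  have hv0 : 0 ≤ v := by rw [hv]; nlinarith [mul_nonneg hε hε, mul_nonneg ht0 (mul_nonneg hε hε)]
  have hvε : v ≤ ε := by rw [hv]; nlinarith [mul_nonneg h1t.le (mul_nonneg hε hε)]
  have hd : 0 < 1 + t * v := by positivity
  have hp : jumpProb t (scaledParam t ε) = v / (1 + t * v) := by
    have h1 : 1 - scaledParam t ε * scaledParam t ε = (1 - t) * v := by
      rw [scaledParam, hv]; ring
    have h2 : 1 - t * (scaledParam t ε * scaledParam t ε) = (1 - t) * (1 + t * v) := by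
      rw [scaledParam, hv]; ring
    rw [jumpProb, h1, h2, mul_div_mul_left _ _ h1t.ne']
  have hle : v / (1 + t * v) ≤ v := div_le_self hv0 (by nlinarith)
  have hge : v - v ^ 2 ≤ v / (1 + t * v) := by
    rw [le_div_iff₀ hd]
    have h1 : t * v ^ 2 ≤ v ^ 2 := by nlinarith [sq_nonneg v]
    have h2 : 0 ≤ t * v ^ 3 := by positivity
    nlinarith
  rw [hp]
  refine ⟨by positivity, hle.trans hvε, ?_⟩
  have hv2 : v ^ 2 ≤ ε ^ 2 := by gcongr
  rw [abs_le]
  constructor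
  · have : (1 - t) * ε ^ 2 / 4 ≤ ε ^ 2 := by nlinarith [sq_nonneg ε]
    linarith
  · nlinarith [sq_nonneg ε]

end Scaling

lemma sum_range_choose_eq (m k : ℕ) : ∑ j ∈ Finset.range m, j.choose k = m.choose (k + 1) := by
  induction m with
  | zero => simp
  | succ m ih => rw [Finset.sum_range_succ, ih, Nat.choose_succ_succ', add_comm]

section Comparison

variable {Ω : Type*} {mΩ : MeasurableSpace Ω} {μ : Measure Ω} [IsProbabilityMeasure μ]
  {𝓕 : Filtration ℝ≥0 mΩ} {η : ℝ≥0 → Ω → ASEPConfig} {t : ℝ}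

/-- Difference between the expectations of an observable in half-line ASEP at time `n ε` and in row
`n` of the six-vertex model at scale `ε`. -/
noncomputable def meanDiff (μ : Measure Ω) (η : ℝ≥0 → Ω → ASEPConfig) (t ε : ℝ)
    (f : ASEPConfig → ℝ) (n : ℕ) : ℝ :=
  asepMean μ η f (n * ε) - holesMean t (scaledParam t ε) f n

lemma abs_asepMean_le {f : ASEPConfig → ℝ} {M : ℝ} (hM : ∀ η, |f η| ≤ M) (s : ℝ) :
    |asepMean μ η f s| ≤ M := by
  refine (abs_integral_le_integral_abs).trans ((integral_mono_of_nonneg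
    (ae_of_all _ fun _ => abs_nonneg _) (integrable_const M) (ae_of_all _ fun ω => hM _)).trans ?_)
  simp

lemma abs_holesMean_le {a : ℝ} {f : ASEPConfig → ℝ} {M : ℝ} (hM : ∀ η, |f η| ≤ M) (n : ℕ) :
    |holesMean t a f n| ≤ M := by
  refine (abs_integral_le_integral_abs).trans ((integral_mono_of_nonneg
    (ae_of_all _ fun _ => abs_nonneg _) (integrable_const M) (ae_of_all _ fun ω => hM _)).trans ?_)
  simp

lemma abs_meanDiff_le_two {ε : ℝ} {L : ℕ} {f : ASEPConfig → ℝ} (hf : IsLocalObservable L f)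
    (n : ℕ) : |meanDiff μ η t ε f n| ≤ 2 := by
  have h1 := abs_asepMean_le (μ := μ) (η := η) hf.abs_le (n * ε)
  have h2 := abs_holesMean_le (t := t) (a := scaledParam t ε) hf.abs_le n
  have := abs_sub (asepMean μ η f (n * ε)) (holesMean t (scaledParam t ε) f n)
  unfold meanDiff; linarith

/-- The differences of the expectations satisfy a hierarchy of integral inequalities, in which an
observable of `L` sites is controlled by observables of `L + 1` sites. -/
lemma abs_meanDiff_add_le (hη : IsHalfLineASEP 1 t (1 / 2) (t / 2) μ 𝓕 η) (ht0 : 0 ≤ t)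
    (ht1 : t < 1) {ε : ℝ} (hε : 0 ≤ ε) (hε1 : ε ≤ 1) {L : ℕ} {f : ASEPConfig → ℝ}
    (hf : IsLocalObservable L f) (n m : ℕ) :
    |meanDiff μ η t ε f (n + m)| ≤ |meanDiff μ η t ε f n| + 2 * (L + 1) * ε *
      ∑ j ∈ Finset.range m, |meanDiff μ η t ε
        (fun η => (2 * ((L : ℝ) + 1))⁻¹ * asepGenerator 1 t (1 / 2) (t / 2) f η) (n + j)|
      + 14 * (L + 3) ^ 4 * (ε * (1 + m * ε)) := by
  obtain ⟨hp0, hpε, hpd⟩ := jumpProb_scaledParam ht0 ht1 hε hε1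
  have hA := hη.abs_asepMean_sub_sum_le ht0 ht1 hf hε n m
  have hB := abs_holesMean_sub_sum_le ht0 ht1 hp0 (hpε.trans hε1) n m hf
  set a := scaledParam t ε
  set p := jumpProb t a
  set g := asepGenerator 1 t (1 / 2) (t / 2) f with hg
  have hL : (0 : ℝ) < 2 * (L + 1) := by positivity
  have hsum : 2 * (L + 1) * ∑ j ∈ Finset.range m, |meanDiff μ η t ε
        (fun η => (2 * ((L : ℝ) + 1))⁻¹ * g η) (n + j)| =
      ∑ j ∈ Finset.range m, |asepMean μ η g ((n + j : ℕ) * ε) - holesMean t a g (n + j)| := by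
    rw [Finset.mul_sum]
    refine Finset.sum_congr rfl fun j _ => ?_
    simp only [meanDiff, asepMean, holesMean, integral_const_mul]
    rw [← mul_sub, abs_mul, abs_of_pos (inv_pos.2 hL), mul_inv_cancel_left₀ hL.ne']
  rw [mul_right_comm, hsum]
  set SA := ∑ j ∈ Finset.range m, asepMean μ η g ((n + j : ℕ) * ε)
  set SB := ∑ j ∈ Finset.range m, holesMean t a g (n + j)
  have h1 : |SA - SB| ≤
      ∑ j ∈ Finset.range m, |asepMean μ η g ((n + j : ℕ) * ε) - holesMean t a g (n + j)| := by
    rw [← Finset.sum_sub_distrib]; exact Finset.abs_sum_le_sum_abs _ _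
  have h2 : |SB| ≤ m * (2 * (L + 1)) := by
    refine (Finset.abs_sum_le_sum_abs _ _).trans ((Finset.sum_le_sum fun j _ =>
      abs_holesMean_le (abs_asepGenerator_le ht0 ht1 hf) _).trans ?_)
    simp
  have h3 : |(ε - p) * SB| ≤ 2 * ε ^ 2 * (m * (2 * (L + 1))) := by
    rw [abs_mul, abs_sub_comm]; gcongr
  have h4 : |ε * (SA - SB)| ≤ (∑ j ∈ Finset.range m,
      |asepMean μ η g ((n + j : ℕ) * ε) - holesMean t a g (n + j)|) * ε := by
    rw [abs_mul, abs_of_nonneg hε, mul_comm]; gcongr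
  have e : meanDiff μ η t ε f (n + m) = meanDiff μ η t ε f n + ε * (SA - SB) + (ε - p) * SB +
      (asepMean μ η f ((n + m : ℕ) * ε) - asepMean μ η f (n * ε) - ε * SA) -
      (holesMean t a f (n + m) - holesMean t a f n - p * SB) := by
    simp only [meanDiff, a]; ring
  set X := asepMean μ η f ((n + m : ℕ) * ε) - asepMean μ η f (n * ε) - ε * SA
  set Y := holesMean t a f (n + m) - holesMean t a f n - p * SB
  have h5 : |meanDiff μ η t ε f (n + m)| ≤
      |meanDiff μ η t ε f n| + |ε * (SA - SB)| + |(ε - p) * SB| + |X| + |Y| := by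
    rw [e]
    have i1 := abs_sub (meanDiff μ η t ε f n + ε * (SA - SB) + (ε - p) * SB + X) Y
    have i2 := abs_add_le (meanDiff μ η t ε f n + ε * (SA - SB) + (ε - p) * SB) X
    have i3 := abs_add_three (meanDiff μ η t ε f n) (ε * (SA - SB)) ((ε - p) * SB)
    linarith
  have hL0 : (0 : ℝ) ≤ L := Nat.cast_nonneg L
  have b1 : ((L : ℝ) + 2) ^ 2 ≤ (L + 3) ^ 4 :=
    (pow_le_pow_left₀ (by linarith) (by linarith : (L : ℝ) + 2 ≤ L + 3) 2).trans
      (pow_le_pow_right₀ (by linarith) (by norm_num))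
  have b2 : ((L : ℝ) + 1) ≤ (L + 3) ^ 4 := by
    have := pow_le_pow_right₀ (by linarith : (1 : ℝ) ≤ (L : ℝ) + 3) (by norm_num : 1 ≤ 4)
    rw [pow_one] at this
    linarith
  have c1 : 4 * ((L : ℝ) + 2) ^ 2 * (m * ε ^ 2) ≤ 4 * (L + 3) ^ 4 * (m * ε ^ 2) := by gcongr
  have c2 : 2 * ε ^ 2 * (m * (2 * ((L : ℝ) + 1))) ≤ 4 * (L + 3) ^ 4 * (m * ε ^ 2) := by
    calc _ = 4 * ((L : ℝ) + 1) * (m * ε ^ 2) := by ring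
      _ ≤ _ := by gcongr
  have c3 : 6 * ((L : ℝ) + 3) ^ 4 * (p + m * p ^ 2) ≤ 6 * (L + 3) ^ 4 * (ε + m * ε ^ 2) := by
    gcongr
  have c4 : 0 ≤ 8 * ((L : ℝ) + 3) ^ 4 * ε := by positivity
  have c5 : 14 * ((L : ℝ) + 3) ^ 4 * (ε * (1 + m * ε)) = 4 * (L + 3) ^ 4 * (m * ε ^ 2) +
    4 * (L + 3) ^ 4 * (m * ε ^ 2) + 6 * (L + 3) ^ 4 * (ε + m * ε ^ 2) +
    8 * ((L : ℝ) + 3) ^ 4 * ε := by ring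
  rw [c5]
  linarith

/-- Uniform closeness, as `ε → 0`, of the two dynamics on local observables up to time `s`. -/
def CloseUpTo (μ : Measure Ω) (η : ℝ≥0 → Ω → ASEPConfig) (t s : ℝ) : Prop :=
  ∀ (L : ℕ) (δ : ℝ), 0 < δ → ∀ᶠ ε in 𝓝[>] (0 : ℝ), ∀ f, IsLocalObservable L f →
    ∀ n : ℕ, n * ε ≤ s → |meanDiff μ η t ε f n| ≤ δ

lemma eventually_pos_le {c : ℝ} (hc : 0 < c) : ∀ᶠ ε in 𝓝[>] (0 : ℝ), 0 < ε ∧ ε ≤ c := by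
  filter_upwards [Ioc_mem_nhdsGT hc] with ε hε using hε

/-- The hierarchy iterated `k` times. -/
lemma CloseUpTo.iterate (hη : IsHalfLineASEP 1 t (1 / 2) (t / 2) μ 𝓕 η) (ht0 : 0 ≤ t)
    (ht1 : t < 1) {s : ℝ} (hs : CloseUpTo μ η t s) (k L : ℕ) {δ : ℝ} (hδ : 0 < δ) :
    ∀ᶠ ε in 𝓝[>] (0 : ℝ), ∀ f, IsLocalObservable L f → ∀ n m : ℕ, n * ε ≤ s → m * ε ≤ 1 / 8 →
      |meanDiff μ η t ε f (n + m)| ≤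
        δ + 2 * (2 * ε) ^ k * m.choose k * ((L + k).factorial / L.factorial) := by
  induction k generalizing L δ with
  | zero =>
    refine Eventually.of_forall fun ε f hf n m _ _ => ?_
    have := abs_meanDiff_le_two (μ := μ) (η := η) (t := t) (ε := ε) hf (n + m)
    have h1 : (L.factorial : ℝ) ≠ 0 := by exact_mod_cast L.factorial_ne_zero
    simp only [pow_zero, Nat.choose_zero_right, Nat.cast_one, mul_one, add_zero, div_self h1]
    linarith
  | succ k ih =>
    have hL : (0 : ℝ) < L + 1 := by positivity
    have hδ' : 0 < δ / (L + 1) := by positivity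
    have hc : 0 < δ / (84 * ((L : ℝ) + 3) ^ 4) := by positivity
    filter_upwards [hs L (δ / 3) (by positivity), ih (L + 1) hδ', eventually_pos_le one_pos,
      eventually_pos_le hc] with ε h1 h2 hε hε' f hf n m hn hm
    have h3 := abs_meanDiff_add_le hη ht0 ht1 hε.1.le hε.2 hf n m
    have h4 := h1 f hf n hn
    have h5 : ∑ j ∈ Finset.range m, |meanDiff μ η t ε
        (fun η => (2 * ((L : ℝ) + 1))⁻¹ * asepGenerator 1 t (1 / 2) (t / 2) f η) (n + j)| ≤
        m * (δ / (L + 1)) + 2 * (2 * ε) ^ k * m.choose (k + 1) *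
          ((L + 1 + k).factorial / (L + 1).factorial) := by
      refine (Finset.sum_le_sum fun j hj => h2 _ (hf.asepGenerator ht0 ht1) n j hn ?_).trans
        (le_of_eq ?_)
      · have : (j : ℝ) ≤ m := by exact_mod_cast (Finset.mem_range.1 hj).le
        have h := hε.1
        nlinarith
      · rw [Finset.sum_add_distrib, ← Finset.sum_mul, ← Finset.mul_sum, ← sum_range_choose_eq]
        simp
    have h6 : 2 * ((L : ℝ) + 1) * ε * ∑ j ∈ Finset.range m, |meanDiff μ η t ε
        (fun η => (2 * ((L : ℝ) + 1))⁻¹ * asepGenerator 1 t (1 / 2) (t / 2) f η) (n + j)| ≤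
        2 * (m * ε) * δ + 2 * (2 * ε) ^ (k + 1) * m.choose (k + 1) *
          ((L + (k + 1)).factorial / L.factorial) := by
      have hpos := hε.1
      refine (mul_le_mul_of_nonneg_left h5 (by positivity)).trans (le_of_eq ?_)
      have e1 : L + 1 + k = L + (k + 1) := by omega
      have h1 : (L.factorial : ℝ) ≠ 0 := by exact_mod_cast L.factorial_ne_zero
      rw [e1, Nat.factorial_succ L]
      push_cast
      field_simp
      ring
    have h7 : 14 * ((L : ℝ) + 3) ^ 4 * (ε * (1 + m * ε)) ≤ δ / 3 := by
      have h8 : ε * (1 + m * ε) ≤ ε * 2 := by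
        have := hε.1
        gcongr; linarith
      calc _ ≤ 14 * ((L : ℝ) + 3) ^ 4 * (δ / (84 * ((L : ℝ) + 3) ^ 4) * 2) := by
            refine mul_le_mul_of_nonneg_left (h8.trans ?_) (by positivity)
            exact mul_le_mul_of_nonneg_right hε'.2 zero_le_two
        _ = δ / 3 := by field_simp; norm_num
    have h8 : 2 * (m * ε) * δ ≤ δ / 4 := by nlinarith
    linarith

/-- Closeness extends by a time step that does not depend on the number of sites, because the
iterated hierarchy has the form of a power series with a fixed radius of convergence. -/
lemma CloseUpTo.add (hη : IsHalfLineASEP 1 t (1 / 2) (t / 2) μ 𝓕 η) (ht0 : 0 ≤ t)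
    (ht1 : t < 1) {s : ℝ} (hs0 : 0 ≤ s) (hs : CloseUpTo μ η t s) :
    CloseUpTo μ η t (s + 1 / 16) := by
  intro L δ hδ
  obtain ⟨k, hk⟩ := exists_pow_lt_of_lt_one (by positivity : 0 < δ / 2 / 2 ^ (L + 1))
    (by norm_num : (1 / 2 : ℝ) < 1)
  have hδ2 : 0 < δ / 2 := by positivity
  filter_upwards [hs L δ hδ, hs.iterate hη ht0 ht1 k L hδ2,
    eventually_pos_le (by norm_num : (0 : ℝ) < 1 / 16)] with ε h1 h2 hε f hf N hN
  by_cases hNs : N * ε ≤ s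
  · exact h1 f hf N hNs
  have hpos := hε.1
  set n := ⌊s / ε⌋₊ with hn
  have hnle : n * ε ≤ s := by
    rw [← le_div_iff₀ hpos]; exact Nat.floor_le (by positivity)
  have hnlt : s < (n + 1) * ε := by
    rw [← div_lt_iff₀ hpos]; exact Nat.lt_floor_add_one _
  have hnN : n ≤ N := by
    have : (n : ℝ) * ε < N * ε := by linarith [not_le.1 hNs]
    exact_mod_cast (lt_of_mul_lt_mul_right this hpos.le).le
  obtain ⟨m, rfl⟩ := Nat.exists_eq_add_of_le hnN
  have hm : m * ε ≤ 1 / 8 := by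
    push_cast at hN
    linarith [hε.2]
  refine (h2 f hf n m hnle hm).trans ?_
  have h3 : (2 * ε) ^ k * m.choose k * ((L + k).factorial / L.factorial) ≤
      (1 / 4) ^ k * 2 ^ (L + k) := by
    have hch : (m.choose k : ℝ) ≤ m ^ k / k.factorial := Nat.choose_le_pow_div k m
    have hfac : ((L + k).factorial : ℝ) / L.factorial = (L + k).choose k * k.factorial := by
      have h1 : (L.factorial : ℝ) ≠ 0 := by exact_mod_cast L.factorial_ne_zero
      have h4 := Nat.add_choose_mul_factorial_mul_factorial L k
      rw [div_eq_iff h1, ← h4]; push_cast; ring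
    have hpw : ((L + k).choose k : ℝ) ≤ 2 ^ (L + k) := by exact_mod_cast Nat.choose_le_two_pow _ _
    have hkf : (k.factorial : ℝ) ≠ 0 := by exact_mod_cast k.factorial_ne_zero
    rw [hfac]
    calc (2 * ε) ^ k * m.choose k * ((L + k).choose k * k.factorial)
        ≤ (2 * ε) ^ k * (m ^ k / k.factorial) * (2 ^ (L + k) * k.factorial) := by gcongr
      _ = (2 * (m * ε)) ^ k * 2 ^ (L + k) := by
          rw [mul_pow, mul_pow, mul_pow]; field_simp
      _ ≤ (1 / 4) ^ k * 2 ^ (L + k) := by gcongr; linarith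
  have h4 : 2 * ((1 / 4 : ℝ) ^ k * 2 ^ (L + k)) = (1 / 2) ^ k * 2 ^ (L + 1) := by
    have : (1 / 4 : ℝ) ^ k * 2 ^ k = (1 / 2) ^ k := by rw [← mul_pow]; norm_num
    rw [pow_add, pow_succ, ← this]; ring
  have h5 : (1 / 2 : ℝ) ^ k * 2 ^ (L + 1) ≤ δ / 2 := by
    rw [← le_div_iff₀ (by positivity)]; exact hk.le
  have h6 : 2 * (2 * ε) ^ k * m.choose k * ((L + k).factorial / L.factorial) =
    2 * ((2 * ε) ^ k * m.choose k * ((L + k).factorial / L.factorial)) := by ring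
  rw [h6]
  linarith

lemma closeUpTo (hη : IsHalfLineASEP 1 t (1 / 2) (t / 2) μ 𝓕 η) (ht0 : 0 ≤ t) (ht1 : t < 1)
    (s : ℝ) : CloseUpTo μ η t s := by
  have h : ∀ k : ℕ, CloseUpTo μ η t (k * (1 / 16)) := by
    intro k
    induction k with
    | zero =>
      intro L δ hδ
      filter_upwards [eventually_pos_le one_pos] with ε hε f hf n hn
      have hn0 : n = 0 := by
        have hpos := hε.1
        by_contra h
        have : 0 < (n : ℝ) := by exact_mod_cast Nat.pos_of_ne_zero h
        have : 0 < (n : ℝ) * ε := by positivity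
        simp at hn
        linarith
      subst hn0
      have h1 : asepMean μ η f 0 = f fun _ => false := by
        have : (fun ω => f (η (0 : ℝ).toNNReal ω)) =ᵐ[μ] fun _ => f fun _ => false := by
          filter_upwards [hη.initial] with ω hω
          rw [Real.toNNReal_zero, hω]
        rw [asepMean, integral_congr_ae this]; simp
      have h2 : holesMean t (scaledParam t ε) f 0 = f fun _ => false := by
        have : ∀ U, asepSites (holes t (scaledParam t ε) U 0) = fun _ => false := fun U => by
          rw [holes_zero]; rfl
        simp [holesMean, this]
      simp [meanDiff, h1, h2, hδ.le]
    | succ k ih =>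
      have := ih.add hη ht0 ht1 (by positivity)
      have e : ((k + 1 : ℕ) : ℝ) * (1 / 16) = k * (1 / 16) + 1 / 16 := by push_cast; ring
      rwa [e]
  intro L δ hδ
  obtain ⟨k, hk⟩ := exists_nat_ge (s * 16)
  filter_upwards [h k L δ hδ] with ε hε f hf n hn
  exact hε f hf n (by linarith)

/-- Convergence of the expectations of local observables. -/
lemma tendsto_holesMean (hη : IsHalfLineASEP 1 t (1 / 2) (t / 2) μ 𝓕 η) (ht0 : 0 ≤ t)
    (ht1 : t < 1) {s : ℝ} (hs : 0 ≤ s) {L : ℕ} {f : ASEPConfig → ℝ} (hf : IsLocalObservable L f) :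
    Tendsto (fun ε => holesMean t (scaledParam t ε) f ⌊s / ε⌋₊) (𝓝[>] 0) (𝓝 (asepMean μ η f s)) := by
  rw [Metric.tendsto_nhds]
  intro δ hδ
  have hc : 0 < δ / (8 * ((L : ℝ) + 1)) := by positivity
  filter_upwards [closeUpTo hη ht0 ht1 s L (δ / 2) (by positivity), eventually_pos_le hc]
    with ε h1 hε
  have hpos := hε.1
  have hnle : ⌊s / ε⌋₊ * ε ≤ s := by
    rw [← le_div_iff₀ hpos]; exact Nat.floor_le (by positivity)
  have hnlt : s < (⌊s / ε⌋₊ + 1) * ε := by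
    rw [← div_lt_iff₀ hpos]; exact Nat.lt_floor_add_one _
  have h2 := h1 f hf _ hnle
  have h3 := hη.abs_asepMean_sub_le ht0 ht1 hf (by positivity) hnle
  have h4 : 2 * ((L : ℝ) + 1) * (s - ⌊s / ε⌋₊ * ε) ≤ δ / 4 := by
    calc _ ≤ 2 * ((L : ℝ) + 1) * (δ / (8 * ((L : ℝ) + 1))) := by
          gcongr; linarith [hε.2]
      _ = δ / 4 := by field_simp; norm_num
  rw [dist_comm, Real.dist_eq]
  rw [meanDiff] at h2
  have h5 := abs_add_le (asepMean μ η f s - asepMean μ η f (⌊s / ε⌋₊ * ε))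
    (asepMean μ η f (⌊s / ε⌋₊ * ε) - holesMean t (scaledParam t ε) f ⌊s / ε⌋₊)
  rw [sub_add_sub_cancel] at h5
  linarith

end Comparison

/-! ### Tightness and convergence of bounded functions -/

section Tail

variable {t a : ℝ}

/-- The front of the holes advances by at most one site per row, and only through a vertex whose
sample lies below the jump probability. -/
lemma exists_holes_succ {U : SixVertexSpace} (ht1 : t < 1) (hp0 : 0 ≤ jumpProb t a) {n K : ℕ}
    (h : ∃ i ≥ K + 1, holes t a U (n + 1) i = true) :
    (∃ i ≥ K + 1, holes t a U n i = true) ∨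
      (∃ i ≥ K, holes t a U n i = true) ∧ (U (bondVertex n K) : ℝ) ≤ jumpProb t a := by
  by_contra! hcon
  obtain ⟨hξ, hK⟩ := hcon
  have hW : ∀ d i, K + 1 ≤ i → n + 1 ≤ i + d → holeCarry t a U n i = false := by
    intro d
    induction d with
    | zero => intro i _ hi; simp [holeCarry, Nat.not_le.2 (by omega : n < i)]
    | succ d ih =>
      intro i hi hd
      have hu := holes_update t a U n i
      split_ifs at hu
      · rw [hu.1]; exact ih _ (by omega) (by omega)
      · rw [hu.1]; simpa using hξ i hi
  obtain ⟨i, hi, hi'⟩ := h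
  obtain ⟨j, rfl⟩ : ∃ j, i = j + 1 := ⟨i - 1, by omega⟩
  have hu := holes_update t a U n j
  have hWj := hW (n + 1) (j + 1) (by omega) (by omega)
  rw [hi', hWj] at hu
  split_ifs at hu with hc
  · have hξj := hu.2.symm
    have hjK : j = K := by
      by_contra hne
      exact hξ j (by omega) hξj
    subst hjK
    refine absurd (hK ⟨j, le_rfl, hξj⟩) (not_lt.2 (hc.trans ?_))
    have := bondRate_le_one ht1 false (holes t a U n j)
    nlinarith
  · simp at hu

open scoped Classical in
/-- The indicator function of the presence of a particle at some site `i ≥ K`. -/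
noncomputable def farIndicator (K : ℕ) (ξ : ℕ → Bool) : ℝ := if ∃ i ≥ K, ξ i = true then 1 else 0

lemma measurable_farIndicator (K : ℕ) : Measurable (farIndicator K) := by
  classical
  refine Measurable.ite ?_ measurable_const measurable_const
  have : {ξ : ℕ → Bool | ∃ i ≥ K, ξ i = true} = ⋃ i ≥ K, {ξ | ξ i = true} := by ext; simp
  rw [this]
  exact MeasurableSet.iUnion fun i => MeasurableSet.iUnion fun _ =>
    measurableSet_eq_fun (measurable_pi_apply i) measurable_const

lemma farIndicator_nonneg (K : ℕ) (ξ : ℕ → Bool) : 0 ≤ farIndicator K ξ := by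
  unfold farIndicator; split_ifs <;> norm_num

lemma farIndicator_le_one (K : ℕ) (ξ : ℕ → Bool) : farIndicator K ξ ≤ 1 := by
  unfold farIndicator; split_ifs <;> norm_num

lemma abs_farIndicator_le (K : ℕ) (ξ : ℕ → Bool) : |farIndicator K ξ| ≤ 1 := by
  rw [abs_of_nonneg (farIndicator_nonneg K ξ)]; exact farIndicator_le_one K ξ

lemma integral_farIndicator_holes_le (ht1 : t < 1) (hp0 : 0 ≤ jumpProb t a)
    (hp1 : jumpProb t a ≤ 1) (n K : ℕ) :
    ∫ U, farIndicator K (holes t a U n) ∂sixVertexMeasure ≤ n.choose K * jumpProb t a ^ K := by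
  induction n generalizing K with
  | zero =>
    rcases K with _ | K
    · simp [holes_zero, farIndicator]
    · simp [holes_zero, farIndicator]
  | succ n ih =>
    have hint : ∀ m K, Integrable (fun U => farIndicator K (holes t a U m)) sixVertexMeasure :=
      fun m K => integrable_of_bounded_holes (measurable_farIndicator K) (abs_farIndicator_le K)
    rcases K with _ | K
    · refine (integral_mono (hint _ _) (integrable_const 1) fun U => farIndicator_le_one _ _).trans ?_
      simp
    · have hind := integral_indicator_le_mul_holes (t := t) (a := a) n K hp0 hp1
        (measurable_farIndicator K)
      have hint2 : Integrable (fun U : SixVertexSpace =>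
          (if (U (bondVertex n K) : ℝ) ≤ jumpProb t a then 1 else 0) *
            farIndicator K (holes t a U n)) sixVertexMeasure := by
        refine Integrable.of_bound (C := 1) (Measurable.aestronglyMeasurable ?_)
          (ae_of_all _ fun U => ?_)
        · exact (Measurable.ite (measurableSet_le (measurable_subtype_coe.comp
            (measurable_pi_apply _)) measurable_const) measurable_const measurable_const).mul
            ((measurable_farIndicator K).comp (measurable_holes t a n))
        · split_ifs
          · simpa using abs_farIndicator_le _ _
          · simp
      have hle : ∀ U : SixVertexSpace, farIndicator (K + 1) (holes t a U (n + 1)) ≤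
          farIndicator (K + 1) (holes t a U n) +
            (if (U (bondVertex n K) : ℝ) ≤ jumpProb t a then 1 else 0) *
            farIndicator K (holes t a U n) := by
        intro U
        have hnn : 0 ≤ (if (U (bondVertex n K) : ℝ) ≤ jumpProb t a then (1 : ℝ) else 0) *
            farIndicator K (holes t a U n) := by
          refine mul_nonneg ?_ (farIndicator_nonneg _ _); split_ifs <;> norm_num
        have hnn' := farIndicator_nonneg (K + 1) (holes t a U n)
        by_cases h : ∃ i ≥ K + 1, holes t a U (n + 1) i = true
        · have e : farIndicator (K + 1) (holes t a U (n + 1)) = 1 := if_pos h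
          rcases exists_holes_succ ht1 hp0 h with h1 | ⟨h1, h2⟩
          · have e1 : farIndicator (K + 1) (holes t a U n) = 1 := if_pos h1
            linarith
          · have e1 : farIndicator K (holes t a U n) = 1 := if_pos h1
            rw [if_pos h2, e1] at hnn ⊢
            linarith
        · have e : farIndicator (K + 1) (holes t a U (n + 1)) = 0 := if_neg h
          linarith
      refine (integral_mono (hint _ _) ((hint _ _).add hint2) hle).trans ?_
      simp only [Pi.add_apply]
      rw [integral_add (hint _ _) hint2, hind]
      have h1 := ih (K + 1)
      have h2 := mul_le_mul_of_nonneg_left (ih K) hp0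
      rw [Nat.choose_succ_succ']
      push_cast
      calc _ ≤ n.choose (K + 1) * jumpProb t a ^ (K + 1) +
            jumpProb t a * (n.choose K * jumpProb t a ^ K) := add_le_add h1 h2
        _ = _ := by ring

lemma integral_farIndicator_scaled_le (ht0 : 0 ≤ t) (ht1 : t < 1) {ε s : ℝ} (hε : 0 < ε)
    (hε1 : ε ≤ 1) (hs : 0 ≤ s) (K : ℕ) :
    ∫ U, farIndicator K (holes t (scaledParam t ε) U ⌊s / ε⌋₊) ∂sixVertexMeasure
      ≤ s ^ K / K.factorial := by
  obtain ⟨hp0, hpε, -⟩ := jumpProb_scaledParam ht0 ht1 hε.le hε1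
  refine (integral_farIndicator_holes_le ht1 hp0 (hpε.trans hε1) _ K).trans ?_
  have hnle : ⌊s / ε⌋₊ * ε ≤ s := by
    rw [← le_div_iff₀ hε]; exact Nat.floor_le (by positivity)
  calc _ ≤ (⌊s / ε⌋₊ : ℝ) ^ K / K.factorial * ε ^ K := by
        gcongr; exact Nat.choose_le_pow_div _ _
    _ = (⌊s / ε⌋₊ * ε) ^ K / K.factorial := by rw [mul_pow]; ring
    _ ≤ _ := by gcongr

end Tail

section ASEPTail

variable {Ω : Type*} {mΩ : MeasurableSpace Ω} {μ : Measure Ω} [IsProbabilityMeasure μ]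
  {𝓕 : Filtration ℝ≥0 mΩ} {η : ℝ≥0 → Ω → ASEPConfig} {t : ℝ}

open scoped Classical in
/-- The indicator function of the presence of a particle at some site in `[K, M]`. -/
noncomputable def windowIndicator (K M : ℕ) (ξ : ASEPConfig) : ℝ :=
  if ∃ i : ℕ+, K ≤ i ∧ i ≤ M ∧ ξ i = true then 1 else 0

lemma isLocalObservable_windowIndicator (K M : ℕ) : IsLocalObservable M (windowIndicator K M) where
  dependsOn ξ ξ' h := by
    have : (∃ i : ℕ+, K ≤ i ∧ i ≤ M ∧ ξ i = true) ↔ ∃ i : ℕ+, K ≤ i ∧ i ≤ M ∧ ξ' i = true := by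
      refine exists_congr fun i => and_congr_right fun _ => and_congr_right fun hi => ?_
      rw [h i hi]
    classical exact if_congr this rfl rfl
  abs_le ξ := by unfold windowIndicator; split_ifs <;> simp

/-- The tail bound passes from the six-vertex model to half-line ASEP through local observables. -/
lemma measureReal_exists_ge_le (hη : IsHalfLineASEP 1 t (1 / 2) (t / 2) μ 𝓕 η) (ht0 : 0 ≤ t)
    (ht1 : t < 1) (s : ℝ≥0) (K : ℕ) :
    μ.real {ω | ∃ i : ℕ+, K ≤ i ∧ η s ω i = true} ≤ (s : ℝ) ^ K / K.factorial := by
  have hwin : ∀ M, asepMean μ η (windowIndicator K M) s ≤ (s : ℝ) ^ K / K.factorial := by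
    intro M
    refine le_of_tendsto (tendsto_holesMean hη ht0 ht1 s.coe_nonneg (isLocalObservable_windowIndicator K M)) ?_
    filter_upwards [eventually_pos_le one_pos] with ε hε
    refine le_trans ?_ (integral_farIndicator_scaled_le ht0 ht1 hε.1 hε.2 s.coe_nonneg K)
    refine integral_mono_of_nonneg (ae_of_all _ fun U => ?_)
      (integrable_of_bounded_holes (measurable_farIndicator K) (abs_farIndicator_le K))
      (ae_of_all _ fun U => ?_)
    · simp only [windowIndicator]; split_ifs <;> simp
    · simp only [windowIndicator, farIndicator]
      split_ifs with h1 h2 h2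
      · exact le_rfl
      · obtain ⟨i, hi, -, hi'⟩ := h1
        exact absurd ⟨i, hi, hi'⟩ h2
      · exact zero_le_one
      · exact le_rfl
  set A := {ω | ∃ i : ℕ+, K ≤ i ∧ η s ω i = true} with hAdef
  have hA : MeasurableSet A := by
    have : A = ⋃ i : ℕ+, ⋃ _ : K ≤ i, {ω | η s ω i = true} := by ext; simp [hAdef]
    rw [this]
    exact MeasurableSet.iUnion fun i => MeasurableSet.iUnion fun _ => measurableSet_eq_fun
      ((measurable_pi_apply i).comp (hη.measurable_config s)) measurable_const
  have hlim : Tendsto (fun M => asepMean μ η (windowIndicator K M) s) atTop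
      (𝓝 (∫ ω, A.indicator 1 ω ∂μ)) := by
    refine tendsto_integral_of_dominated_convergence (fun _ => 1) (fun M => ?_)
      (integrable_const 1) (fun M => ae_of_all _ fun ω =>
        (isLocalObservable_windowIndicator K M).abs_le _) (ae_of_all _ fun ω => ?_)
    · exact (((isLocalObservable_windowIndicator K M).dependsOn.measurable_bool
        (finite_pnat_le M)).comp (hη.measurable_config _)).aestronglyMeasurable
    · rw [Real.toNNReal_coe]
      refine tendsto_const_nhds.congr' ?_
      by_cases h : ω ∈ A
      · obtain ⟨i, hi, hi'⟩ := h
        filter_upwards [eventually_ge_atTop (i : ℕ)] with M hM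
        have : windowIndicator K M (η s ω) = 1 := if_pos ⟨i, hi, hM, hi'⟩
        rw [this, Set.indicator_of_mem (show ω ∈ A from ⟨i, hi, hi'⟩)]; rfl
      · refine Eventually.of_forall fun M => ?_
        have : windowIndicator K M (η s ω) = 0 :=
          if_neg fun ⟨i, hi, _, hi'⟩ => h ⟨i, hi, hi'⟩
        simp only [this, Set.indicator_of_notMem h]
  rw [integral_indicator_one hA] at hlim
  exact le_of_tendsto hlim (Eventually.of_forall hwin)

lemma ae_exists_forall_lt (hη : IsHalfLineASEP 1 t (1 / 2) (t / 2) μ 𝓕 η) (ht0 : 0 ≤ t)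
    (ht1 : t < 1) (s : ℝ≥0) : ∀ᵐ ω ∂μ, ∃ K : ℕ, ∀ i : ℕ+, η s ω i = true → (i : ℕ) < K := by
  rw [ae_iff]
  set B := {ω | ¬∃ K : ℕ, ∀ i : ℕ+, η s ω i = true → (i : ℕ) < K} with hB
  have hle : ∀ K : ℕ, μ.real B ≤ (s : ℝ) ^ K / K.factorial := by
    intro K
    refine (measureReal_mono fun ω hω => ?_).trans (measureReal_exists_ge_le hη ht0 ht1 s K)
    have hω' : ¬∃ K : ℕ, ∀ i : ℕ+, η s ω i = true → (i : ℕ) < K := hω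
    push Not at hω'
    obtain ⟨i, hi, hi'⟩ := hω' K
    exact ⟨i, hi', hi⟩
  have h0 : μ.real B ≤ 0 := ge_of_tendsto' (FloorSemiring.tendsto_pow_div_factorial_atTop (s : ℝ)) hle
  exact (measureReal_eq_zero_iff).1 (le_antisymm h0 measureReal_nonneg)

end ASEPTail

section Convergence

/-- The configuration `ξ` with all particles beyond site `K` removed. -/
def truncateConfig (K : ℕ) (ξ : ASEPConfig) : ASEPConfig := fun i => decide ((i : ℕ) ≤ K) && ξ i

lemma truncateConfig_eq_self {K : ℕ} {ξ : ASEPConfig} (h : ∀ i : ℕ+, ξ i = true → (i : ℕ) ≤ K) :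
    truncateConfig K ξ = ξ := by
  ext i
  cases hi : ξ i
  · simp [truncateConfig, hi]
  · simp [truncateConfig, hi, h i hi]

lemma dependsOn_comp_truncateConfig {β : Type*} (Φ : ASEPConfig → β) (K : ℕ) :
    DependsOn (fun ξ => Φ (truncateConfig K ξ)) {i : ℕ+ | (i : ℕ) ≤ K} := by
  intro ξ ξ' h
  simp only
  congr 1
  ext i
  by_cases hi : (i : ℕ) ≤ K
  · simp [truncateConfig, hi, h i hi]
  · simp [truncateConfig, hi]

lemma measurable_comp_truncateConfig {β : Type*} [MeasurableSpace β] (Φ : ASEPConfig → β) (K : ℕ) :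
    Measurable fun ξ => Φ (truncateConfig K ξ) :=
  have : Nonempty β := ⟨Φ fun _ => false⟩
  (dependsOn_comp_truncateConfig Φ K).measurable_bool (finite_pnat_le K)

lemma measurable_asepSites : Measurable asepSites :=
  measurable_pi_lambda _ fun i => measurable_pi_apply (i : ℕ)

lemma truncateConfig_asepSites_holes (t a : ℝ) (U : SixVertexSpace) (n : ℕ) :
    truncateConfig n (asepSites (holes t a U n)) = asepSites (holes t a U n) := by
  refine truncateConfig_eq_self fun i hi => ?_
  by_contra h
  have : holes t a U n i = false := holes_of_le t a U (by omega)
  simp [asepSites, this] at hi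

lemma measurable_comp_holes {β : Type*} [MeasurableSpace β] (Φ : ASEPConfig → β) (t a : ℝ) (n : ℕ) :
    Measurable fun U => Φ (asepSites (holes t a U n)) := by
  have h := (measurable_comp_truncateConfig Φ n).comp
    (measurable_asepSites.comp (measurable_holes t a n))
  simpa only [Function.comp_def, truncateConfig_asepSites_holes] using h

variable {Ω : Type*} {mΩ : MeasurableSpace Ω} {μ : Measure Ω} [IsProbabilityMeasure μ]
  {𝓕 : Filtration ℝ≥0 mΩ} {η : ℝ≥0 → Ω → ASEPConfig} {t : ℝ}

lemma aemeasurable_comp_asep (hη : IsHalfLineASEP 1 t (1 / 2) (t / 2) μ 𝓕 η) (ht0 : 0 ≤ t)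
    (ht1 : t < 1) (s : ℝ≥0) {β : Type*} [MeasurableSpace β] [TopologicalSpace β] [BorelSpace β]
    [TopologicalSpace.PseudoMetrizableSpace β] (Φ : ASEPConfig → β) :
    AEMeasurable (fun ω => Φ (η s ω)) μ := by
  refine aemeasurable_of_tendsto_metrizable_ae atTop
    (f := fun K ω => Φ (truncateConfig K (η s ω)))
    (fun K => ((measurable_comp_truncateConfig Φ K).comp (hη.measurable_config s)).aemeasurable) ?_
  filter_upwards [ae_exists_forall_lt hη ht0 ht1 s] with ω ⟨K, hK⟩
  refine tendsto_const_nhds.congr' ?_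
  filter_upwards [eventually_ge_atTop K] with K' hK'
  rw [truncateConfig_eq_self fun i hi => (hK i hi).le.trans hK']

/-- Convergence of the expectations of all bounded functions: since both dynamics live, up to a small
probability, on a finite set of configurations, local observables suffice. -/
lemma tendsto_integral_comp_holes (hη : IsHalfLineASEP 1 t (1 / 2) (t / 2) μ 𝓕 η) (ht0 : 0 ≤ t)
    (ht1 : t < 1) (s : ℝ≥0) {Φ : ASEPConfig → ℝ} (hΦ : ∀ ξ, |Φ ξ| ≤ 1) :
    Tendsto (fun ε => ∫ U, Φ (asepSites (holes t (scaledParam t ε) U ⌊(s : ℝ) / ε⌋₊))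
      ∂sixVertexMeasure) (𝓝[>] 0) (𝓝 (∫ ω, Φ (η s ω) ∂μ)) := by
  rw [Metric.tendsto_nhds]
  intro δ hδ
  obtain ⟨K, hK⟩ := ((tendsto_add_atTop_iff_nat 1).2
    (FloorSemiring.tendsto_pow_div_factorial_atTop (s : ℝ))).eventually
    (gt_mem_nhds (by positivity : 0 < δ / 6)) |>.exists
  have hloc : IsLocalObservable K (fun ξ => Φ (truncateConfig K ξ)) :=
    ⟨dependsOn_comp_truncateConfig Φ K, fun _ => hΦ _⟩
  have hconv := (tendsto_holesMean hη ht0 ht1 s.coe_nonneg hloc).eventually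
    (Metric.ball_mem_nhds _ (by positivity : 0 < δ / 3))
  have h2 : ∀ ξ ξ', |Φ ξ - Φ ξ'| ≤ 2 := fun ξ ξ' => by
    have := abs_sub (Φ ξ) (Φ ξ')
    linarith [hΦ ξ, hΦ ξ']
  -- the error of the truncation in half-line ASEP
  have hA : |∫ ω, Φ (η s ω) ∂μ - asepMean μ η (fun ξ => Φ (truncateConfig K ξ)) s| ≤ δ / 3 := by
    have i1 : Integrable (fun ω => Φ (η s ω)) μ :=
      Integrable.of_bound (aemeasurable_comp_asep hη ht0 ht1 s Φ).aestronglyMeasurable 1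
        (ae_of_all _ fun _ => hΦ _)
    have i2 : Integrable (fun ω => Φ (truncateConfig K (η s ω))) μ :=
      Integrable.of_bound ((measurable_comp_truncateConfig Φ K).comp
        (hη.measurable_config s)).aestronglyMeasurable 1 (ae_of_all _ fun _ => hΦ _)
    set A := {ω | ∃ i : ℕ+, (K + 1 : ℕ) ≤ i ∧ η s ω i = true} with hAdef
    have hAm : MeasurableSet A := by
      have : A = ⋃ i : ℕ+, ⋃ _ : (K + 1 : ℕ) ≤ i, {ω | η s ω i = true} := by ext; simp [hAdef]
      rw [this]
      exact MeasurableSet.iUnion fun i => MeasurableSet.iUnion fun _ => measurableSet_eq_fun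
        ((measurable_pi_apply i).comp (hη.measurable_config s)) measurable_const
    simp only [asepMean, Real.toNNReal_coe]
    rw [← integral_sub i1 i2]
    have hbd : ∀ ω, |Φ (η s ω) - Φ (truncateConfig K (η s ω))| ≤ 2 * A.indicator 1 ω := by
      intro ω
      by_cases h : ω ∈ A
      · rw [Set.indicator_of_mem h]; simpa using h2 _ _
      · rw [truncateConfig_eq_self, sub_self, abs_zero, Set.indicator_of_notMem h, mul_zero]
        intro i hi
        by_contra hlt
        exact h ⟨i, by omega, hi⟩
    refine (abs_integral_le_integral_abs).trans ((integral_mono_of_nonneg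
      (ae_of_all _ fun _ => abs_nonneg _) (((integrable_const (1 : ℝ)).indicator hAm).const_mul 2)
      (ae_of_all _ hbd)).trans ?_)
    have e : ∫ ω, 2 * A.indicator (fun _ => (1 : ℝ)) ω ∂μ = 2 * μ.real A := by
      rw [integral_const_mul]; congr 1; exact integral_indicator_one hAm
    rw [e]
    have := measureReal_exists_ge_le hη ht0 ht1 s (K + 1)
    linarith
  filter_upwards [hconv, eventually_pos_le one_pos] with ε hε1 hε
  rw [Real.dist_eq] at hε1
  set n := ⌊(s : ℝ) / ε⌋₊
  -- the error of the truncation in the six-vertex model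
  have hB : |∫ U, Φ (asepSites (holes t (scaledParam t ε) U n)) ∂sixVertexMeasure -
      holesMean t (scaledParam t ε) (fun ξ => Φ (truncateConfig K ξ)) n| < δ / 3 := by
    have i1 : Integrable (fun U => Φ (asepSites (holes t (scaledParam t ε) U n)))
        sixVertexMeasure :=
      Integrable.of_bound (measurable_comp_holes Φ t _ n).aestronglyMeasurable 1
        (ae_of_all _ fun _ => hΦ _)
    have i2 : Integrable (fun U => Φ (truncateConfig K (asepSites (holes t (scaledParam t ε) U n))))
        sixVertexMeasure :=
      Integrable.of_bound (measurable_comp_holes (fun ξ => Φ (truncateConfig K ξ)) t _ n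
        ).aestronglyMeasurable 1 (ae_of_all _ fun _ => hΦ _)
    rw [holesMean, ← integral_sub i1 i2]
    have hbd : ∀ U, |Φ (asepSites (holes t (scaledParam t ε) U n)) -
        Φ (truncateConfig K (asepSites (holes t (scaledParam t ε) U n)))| ≤
        2 * farIndicator (K + 1) (holes t (scaledParam t ε) U n) := by
      intro U
      by_cases h : ∃ i ≥ K + 1, holes t (scaledParam t ε) U n i = true
      · have e : farIndicator (K + 1) (holes t (scaledParam t ε) U n) = 1 := if_pos h
        rw [e, mul_one]; exact h2 _ _
      · rw [truncateConfig_eq_self, sub_self, abs_zero]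
        · exact mul_nonneg zero_le_two (farIndicator_nonneg _ _)
        intro i hi
        by_contra hlt
        exact h ⟨i, by omega, hi⟩
    refine lt_of_le_of_lt ((abs_integral_le_integral_abs).trans (integral_mono_of_nonneg
      (ae_of_all _ fun _ => abs_nonneg _) ((integrable_of_bounded_holes
        (measurable_farIndicator (K + 1)) (abs_farIndicator_le _)).const_mul 2)
      (ae_of_all _ hbd))) ?_
    rw [integral_const_mul]
    have := integral_farIndicator_scaled_le ht0 ht1 hε.1 hε.2 s.coe_nonneg (K + 1)
    linarith
  rw [Real.dist_eq]
  set x := ∫ U, Φ (asepSites (holes t (scaledParam t ε) U n)) ∂sixVertexMeasure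
  set y := holesMean t (scaledParam t ε) (fun ξ => Φ (truncateConfig K ξ)) n
  set z := asepMean μ η (fun ξ => Φ (truncateConfig K ξ)) s
  set w := ∫ ω, Φ (η s ω) ∂μ
  rw [abs_sub_comm] at hA
  have e : x - w = (x - y) + (y - z) + (z - w) := by ring
  rw [e]
  have := abs_add_three (x - y) (y - z) (z - w)
  linarith

end Convergence

/-! ### Height function and particle numbers -/

section Counting

variable (t a : ℝ) (U : SixVertexSpace)

lemma bulkOutput_conservation (t b u : ℝ) (i j : Bool) :
    (bulkOutput t b u i j).1.toNat + (bulkOutput t b u i j).2.toNat = i.toNat + j.toNat := by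
  unfold bulkOutput
  split_ifs
  · rfl
  · rfl
  · exact add_comm _ _

lemma sixVertexHeight_eq_sum (b : ℕ → ℝ) (x y : ℕ) :
    sixVertexHeight t b x y U = ∑ i ∈ Finset.range x, (northEdge t b U y (i + 1)).toNat := by
  rw [sixVertexHeight, Finset.card_filter, Finset.range_eq_Ico,
    Finset.sum_Ico_add' (fun i => (northEdge t b U y i).toNat)]
  refine Finset.sum_congr (by ext; simp) fun i _ => ?_
  cases northEdge t b U y i <;> rfl

/-- Conservation of paths in the first `m` vertices of row `n + 1`. -/
lemma sixVertexHeight_add_eastEdge (b : ℕ → ℝ) (n : ℕ) {m : ℕ} (hm : m ≤ n) :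
    sixVertexHeight t b m (n + 1) U +
      (eastEdge t b U (n + 1) (northEdge t b U n) m).toNat = sixVertexHeight t b m n U + 1 := by
  simp only [sixVertexHeight_eq_sum]
  induction m with
  | zero => simp [eastEdge]
  | succ m ih =>
    have h := ih (by omega)
    rw [Finset.sum_range_succ, Finset.sum_range_succ]
    have hc := bulkOutput_conservation t (b (m + 1) * b (n + 1)) (U (m + 1, n + 1))
      (eastEdge t b U (n + 1) (northEdge t b U n) m) (northEdge t b U n (m + 1))
    have hN : northEdge t b U (n + 1) (m + 1) = (bulkOutput t (b (m + 1) * b (n + 1))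
      (U (m + 1, n + 1)) (eastEdge t b U (n + 1) (northEdge t b U n) m)
      (northEdge t b U n (m + 1))).2 := by
      rw [northEdge, if_pos (by omega)]
    rw [hN, eastEdge]
    omega

/-- The corner either absorbs the path that arrives from the west or creates a second one, so that
the number of paths above row `n` is even. -/
lemma even_sixVertexHeight_self (b : ℕ → ℝ) (n : ℕ) : Even (sixVertexHeight t b n n U) := by
  induction n with
  | zero => simp [sixVertexHeight]
  | succ n ih =>
    have h := sixVertexHeight_add_eastEdge t U b n le_rfl
    have hs : sixVertexHeight t b (n + 1) (n + 1) U = sixVertexHeight t b n (n + 1) U +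
        (!eastEdge t b U (n + 1) (northEdge t b U n) n).toNat := by
      rw [sixVertexHeight_eq_sum, Finset.sum_range_succ, ← sixVertexHeight_eq_sum]
      simp [northEdge]
    obtain ⟨k, hk⟩ := ih
    cases he : eastEdge t b U (n + 1) (northEdge t b U n) n
    · rw [he] at h hs
      exact ⟨k + 1, by simp at h hs; omega⟩
    · rw [he] at h hs
      exact ⟨k, by simp at h hs; omega⟩

/-- The height function counts the holes at the sites `i ≥ x`. -/
lemma asepCurrent_holes {x : ℕ+} {n : ℕ} (hx : (x : ℕ) ≤ n) :
    (asepCurrent x (asepSites (holes t a U n)) : ℤ) =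
      (n : ℤ) - (x : ℕ) - sixVertexHeight t (fun _ => a) (n - x) n U := by
  have hcard : (Finset.Icc 1 (n - x)).card = n - x := by simp
  have hsplit := Finset.card_filter_add_card_filter_not (s := Finset.Icc 1 (n - (x : ℕ)))
    (fun i => northEdge t (fun _ => a) U n i = true)
  rw [hcard] at hsplit
  have hn : asepCurrent x (asepSites (holes t a U n)) =
      ((Finset.Icc 1 (n - (x : ℕ))).filter fun i => ¬northEdge t (fun _ => a) U n i = true).card := by
    rw [asepCurrent, ← Set.ncard_coe_finset]
    refine Set.ncard_congr (fun i _ => n - (i : ℕ)) ?_ ?_ ?_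
    · rintro i ⟨hxi, hi⟩
      have hxi' : (x : ℕ) ≤ i := hxi
      simp only [asepSites, holes, Bool.and_eq_true, decide_eq_true_eq, Bool.not_eq_true'] at hi
      simp [hi.2]
      omega
    · rintro i j ⟨-, hi⟩ ⟨-, hj⟩ hij
      simp only [asepSites, holes, Bool.and_eq_true, decide_eq_true_eq] at hi hj
      have hij' : n - (i : ℕ) = n - (j : ℕ) := hij
      exact PNat.coe_injective (by omega)
    · intro c hc
      simp only [Finset.coe_filter, Finset.mem_Icc, Set.mem_ofPred_eq] at hc
      have hx0 := x.pos
      refine ⟨⟨n - c, by omega⟩, ⟨?_, ?_⟩, ?_⟩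
      · change (x : ℕ) ≤ n - c
        omega
      · have : n - (n - c) = c := by omega
        simp [asepSites, holes, this, hc.2]
        omega
      · simp only [PNat.mk_coe]; omega
  rw [hn, sixVertexHeight]
  omega

lemma ceilTwo_eq {k m : ℤ} (hm : Even m) (h1 : k ≤ m) (h2 : m ≤ k + 1) : ceilTwo k = m := by
  refine (isLeast_ceilTwo k).unique ⟨⟨hm, h1⟩, fun i hi => ?_⟩
  obtain ⟨u, rfl⟩ := hi.1
  obtain ⟨v, rfl⟩ := hm
  have := hi.2
  omega

/-- For even `n` the parity of the height determines whether the corner site is empty. -/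
lemma ceilTwo_asepCurrent_holes {n : ℕ} (hn : Even n) (hn1 : 1 ≤ n) :
    ceilTwo (asepCurrent 1 (asepSites (holes t a U n))) =
      (n : ℤ) - sixVertexHeight t (fun _ => a) n n U := by
  have h1 := asepCurrent_holes t a U (x := 1) (n := n) (by simpa using hn1)
  have h2 : sixVertexHeight t (fun _ => a) n n U = sixVertexHeight t (fun _ => a) (n - 1) n U +
      (northEdge t (fun _ => a) U n n).toNat := by
    obtain ⟨m, rfl⟩ : ∃ m, n = m + 1 := ⟨n - 1, by omega⟩
    rw [sixVertexHeight_eq_sum, Finset.sum_range_succ, ← sixVertexHeight_eq_sum]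
    simp
  have h3 : (northEdge t (fun _ => a) U n n).toNat ≤ 1 := Bool.toNat_le _
  have h4 := even_sixVertexHeight_self t U (fun _ => a) n
  rw [PNat.one_coe] at h1
  refine ceilTwo_eq (Even.sub (by exact_mod_cast hn) (by exact_mod_cast h4)) ?_ ?_ <;> omega

lemma measurable_sixVertexHeight (b : ℕ → ℝ) (x y : ℕ) : Measurable (sixVertexHeight t b x y) := by
  have : sixVertexHeight t b x y = fun U =>
      ∑ i ∈ Finset.range x, (northEdge t b U y (i + 1)).toNat := by
    ext U; exact sixVertexHeight_eq_sum t U b x y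
  rw [this]
  exact Finset.measurable_sum _ fun i _ =>
    (Measurable.of_discrete (f := Bool.toNat)).comp (measurable_northEdge _ _)

end Counting

section Distribution

variable {Ω : Type*} {mΩ : MeasurableSpace Ω} {μ : Measure Ω} [IsProbabilityMeasure μ]
  {𝓕 : Filtration ℝ≥0 mΩ} {η : ℝ≥0 → Ω → ASEPConfig} {t : ℝ}

/-- Convergence in distribution of integer-valued functions of the configuration of holes. -/
lemma tendstoInDistribution_of_eq_comp_holes (hη : IsHalfLineASEP 1 t (1 / 2) (t / 2) μ 𝓕 η)
    (ht0 : 0 ≤ t) (ht1 : t < 1) (s : ℝ≥0) (Ψ : ASEPConfig → ℤ) {X : ℝ → SixVertexSpace → ℤ}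
    (hX : ∀ ε, Measurable (X ε)) {l : Filter ℝ} (hl : l ≤ 𝓝[>] 0)
    (hXΨ : ∀ᶠ ε in l, ∀ U, X ε U = Ψ (asepSites (holes t (scaledParam t ε) U ⌊(s : ℝ) / ε⌋₊))) :
    TendstoInDistribution X l (fun ω => Ψ (η s ω)) (fun _ => sixVertexMeasure) μ := by
  have hΨ := aemeasurable_comp_asep hη ht0 ht1 s Ψ
  refine ⟨fun ε => (hX ε).aemeasurable, hΨ, ?_⟩
  refine ProbabilityMeasure.tendsto_iff_forall_integral_tendsto.2 fun F => ?_
  have hF : 0 < ‖F‖ + 1 := by positivity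
  have hbd : ∀ ξ, |(‖F‖ + 1)⁻¹ * F (Ψ ξ)| ≤ 1 := fun ξ => by
    rw [abs_mul, abs_of_pos (inv_pos.2 hF), inv_mul_le_iff₀ hF, mul_one]
    have := F.norm_coe_le_norm (Ψ ξ)
    rw [Real.norm_eq_abs] at this
    linarith
  have h := ((tendsto_integral_comp_holes hη ht0 ht1 s hbd).const_mul (‖F‖ + 1)).mono_left hl
  simp only [integral_const_mul, mul_inv_cancel_left₀ hF.ne'] at h
  change Tendsto (fun ε => ∫ k, F k ∂(sixVertexMeasure.map (X ε))) l
    (𝓝 (∫ k, F k ∂(μ.map fun ω => Ψ (η s ω))))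
  rw [integral_map hΨ F.continuous.aestronglyMeasurable]
  refine h.congr' ?_
  filter_upwards [hXΨ] with ε hε
  rw [integral_map (hX ε).aemeasurable F.continuous.aestronglyMeasurable]
  simp only [hε]

end Distribution

theorem proposition5p2 (t : ℝ) (ht0 : 0 ≤ t) (ht1 : t < 1) (τ : ℝ≥0) (hτ : 0 < τ)
    {Ω : Type*} {mΩ : MeasurableSpace Ω} (μ : Measure Ω) [IsProbabilityMeasure μ]
    (𝓕 : Filtration ℝ≥0 mΩ) (η : ℝ≥0 → Ω → ASEPConfig)
    (hη : IsHalfLineASEP 1 t (1 / 2) (t / 2) μ 𝓕 η) :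
    (∀ᵐ ω ∂μ, {i : ℕ+ | η τ ω i = true}.Finite) ∧
    (∀ x : ℕ+,
      TendstoInDistribution
        (fun (ε : ℝ) (U : SixVertexSpace) =>
          (⌊(τ : ℝ) / ε⌋₊ : ℤ) - (x : ℕ) -
            sixVertexHeight t (fun _ => 1 - (1 - t) * ε / 2)
              (⌊(τ : ℝ) / ε⌋₊ - (x : ℕ)) ⌊(τ : ℝ) / ε⌋₊ U)
        (𝓝[>] (0 : ℝ))
        (fun ω => (asepCurrent x (η τ ω) : ℤ))
        (fun _ => sixVertexMeasure) μ) ∧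
    TendstoInDistribution
      (fun (ε : ℝ) (U : SixVertexSpace) =>
        (⌊(τ : ℝ) / ε⌋₊ : ℤ) -
          sixVertexHeight t (fun _ => 1 - (1 - t) * ε / 2) ⌊(τ : ℝ) / ε⌋₊ ⌊(τ : ℝ) / ε⌋₊ U)
      (𝓝[>] (0 : ℝ) ⊓ 𝓟 {ε : ℝ | Even ⌊(τ : ℝ) / ε⌋₊})
      (fun ω => ceilTwo (asepCurrent 1 (η τ ω)))
      (fun _ => sixVertexMeasure) μ := by
  have hm : ∀ (b : ℕ → ℝ) (x y : ℕ) (c : ℤ), Measurable fun U : SixVertexSpace =>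
      c - (sixVertexHeight t b x y U : ℤ) := fun b x y c =>
    (Measurable.of_discrete (f := fun k : ℕ => c - (k : ℤ))).comp
      (measurable_sixVertexHeight t b x y)
  -- the number of rows tends to infinity
  have hrows : ∀ k : ℕ, ∀ᶠ ε in 𝓝[>] (0 : ℝ), k ≤ ⌊(τ : ℝ) / ε⌋₊ := by
    intro k
    have hτ' : (0 : ℝ) < τ := hτ
    filter_upwards [eventually_pos_le (c := (τ : ℝ) / (k + 1)) (by positivity)] with ε hε
    refine Nat.le_floor ?_
    rw [le_div_iff₀ hε.1]
    have := (le_div_iff₀ (by positivity : (0 : ℝ) < k + 1)).1 hε.2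
    nlinarith [hε.1]
  refine ⟨?_, fun x => ?_, ?_⟩
  · filter_upwards [ae_exists_forall_lt hη ht0 ht1 τ] with ω ⟨K, hK⟩
    exact (finite_pnat_le K).subset fun i hi => (hK i hi).le
  · refine tendstoInDistribution_of_eq_comp_holes hη ht0 ht1 τ (fun ξ => (asepCurrent x ξ : ℤ))
      (fun ε => hm _ _ _ _) le_rfl ?_
    filter_upwards [hrows x] with ε hε U
    exact (asepCurrent_holes t _ U hε).symm
  · refine tendstoInDistribution_of_eq_comp_holes hη ht0 ht1 τ (fun ξ => ceilTwo (asepCurrent 1 ξ))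
      (fun ε => hm _ _ _ _) inf_le_left ?_
    filter_upwards [(hrows 1).filter_mono inf_le_left,
      mem_inf_of_right (mem_principal_self _)] with ε h1 h2 U
    exact (ceilTwo_asepCurrent_holes t _ U h2 h1).symm
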